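/- **Conventions.** A *space* is a Kan complex. A map $f\colon L\to K$ of spaces is an *equivalence* if there are maps $g,h\colon K\to L$ with $fg$ homotopic to $\mathrm{id}_K$ and $hf$ homotopic to $\mathrm{id}_L$; a space $K$ is *contractible* if $K\to\Delta[0]$ is an equivalence. A Kan fibration is *$(-1)$-truncated* if each of its fibres over points is contractible or empty, and a space $K$ is *$(-1)$-truncated* if $K\to\Delta[0]$ is a $(-1)$-truncated Kan fibration. A simplicial space is a functor $X\colon\Delta^{op}\to s\mathrm{Set}$. Write $F(n)$ for the simplicial space $F(n)_{kl}=\mathrm{Hom}_\Delta([k],[n])$, $\partial F(n)$ for its boundary, $G(n)\subset F(n)$ for its spine (generated by the edges $i\to i+1$), $\mathrm{Map}(A,X)_l=\mathrm{Hom}(A\times\Delta[l],X)$, and $(Y^X)_{nl}=\mathrm{Hom}(F(n)\times\Delta[l]\times X,Y)$. A *Segal space* is a simplicial space $T$ for which every $\mathrm{Map}(F(n),T)\to\mathrm{Map}(\partial F(n),T)$, $n\ge 0$, is a Kan fibration and every $T_n\cong\mathrm{Map}(F(n),T)\to\mathrm{Map}(G(n),T)\cong T_1\times_{T_0}\cdots\times_{T_0}T_1$,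 $n\geq 2$, is an equivalence. Its objects are the points of $T_0$; $\mathrm{map}_T(x,y)$ is the fibre of (source, target) $T_1\to T_0\times T_0$ over $(x,y)$; a point $f$ of it is a *homotopy equivalence* if there are points $g,h$ of $\mathrm{map}_T(y,x)$ such that $g\circ f$ is joined by a path to $\mathrm{id}_x$ in $\mathrm{map}_T(x,x)$ and $f\circ h$ by a path to $\mathrm{id}_y$ in $\mathrm{map}_T(y,y)$, where composites are given by points of $T_2$. Let $T_{hoequiv}\subseteq T_1$ be the subspace of all simplices whose vertices are homotopy equivalences. A *complete Segal space* is a Segal space $W$ for which $s_0\colon W_0\to W_{hoequiv}$ is an equivalence. For an object $x$ of a complete Segal space $W$ let $W_{x/}=F(0)\times_W W^{F(1)}$, formed with $x\colon F(0)\to W$ and the source map $W^{F(1)}\to W$, and let $p_x\colon W_{x/}\to W$ be induced by the target map. The object $x$ is *initial* if $p_x$ is a levelwise equivalence. Let $W_{init}\subseteq W_0$ be the subspace of all simplices whose vertices are initial objects. **Lemma.** Let $W$ be a complete Segal space. Then the space $W_{init}$ is $(-1)$-truncated. Hence $W_{init}$ is empty or contractible, and initial objects are unique up to homotopy: any two initial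 objects of $W$ are joined by a path in $W_0$. -/

import Mathlib

open CategoryTheory Opposite Simplicial MonoidalCategory HomotopicalAlgebra

universe u

/-! ### Spaces: Kan complexes, equivalences, contractibility, truncatedness -/

namespace SSet

open modelCategoryQuillen in
/-- A map of simplicial sets is a *Kan fibration* if it has the right lifting property with respect
to the horn inclusions `Λ[n, i] ⟶ Δ[n]`, `n ≥ 1`. -/
abbrev IsKanFibration {K L : SSet.{u}} (p : K ⟶ L) : Prop := Fibration p

/-- A map `f : L ⟶ K` (between Kan complexes) is an *equivalence* if it has a right and a left
inverse up to homotopy. -/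
def IsSpaceEquiv {L K : SSet.{u}} (f : L ⟶ K) : Prop :=
  (∃ g : K ⟶ L, Nonempty (Homotopy (g ≫ f) (𝟙 K))) ∧
    ∃ h : K ⟶ L, Nonempty (Homotopy (f ≫ h) (𝟙 L))

/-- The unique map to the point `Δ[0]`. -/
def toPoint (K : SSet.{u}) : K ⟶ Δ[0] := stdSimplex.isTerminalObj₀.from K

/-- A *contractible* space: a Kan complex for which the map to the point is an equivalence. -/
def IsContractibleSpace (K : SSet.{u}) : Prop := KanComplex K ∧ IsSpaceEquiv K.toPoint

/-- The simplicial set without simplices. -/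
def IsEmptySpace (K : SSet.{u}) : Prop := ∀ n : SimplexCategoryᵒᵖ, IsEmpty (K.obj n)

/-- Two points of a space are *homotopic* if they are joined by a path. -/
def PointsHomotopic (K : SSet.{u}) (a b : K _⦋0⦌) : Prop :=
  ∃ γ : K _⦋1⦌, K.δ 1 γ = a ∧ K.δ 0 γ = b

/-- The fibre of `p : K ⟶ L` over a vertex `y` of `L`: the simplices of `K` that are sent to a
degeneracy of `y`. -/
def fibre {K L : SSet.{u}} (p : K ⟶ L) (y : L _⦋0⦌) : K.Subcomplex :=
  (Subcomplex.ofSimplex y).preimage p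

/-- A *`(-1)`-truncated* map: a Kan fibration each of whose fibres is contractible or empty. -/
def IsNegOneTruncatedMap {K L : SSet.{u}} (p : K ⟶ L) : Prop :=
  IsKanFibration p ∧
    ∀ y : L _⦋0⦌, IsContractibleSpace (fibre p y : SSet.{u}) ∨ IsEmptySpace (fibre p y : SSet.{u})

/-- A *`(-1)`-truncated* space: the map to the point is `(-1)`-truncated. -/
def IsNegOneTruncated (K : SSet.{u}) : Prop := IsNegOneTruncatedMap K.toPoint

/-- The subspace of `K` generated by a set of points: all simplices whose vertices all lie in the
given set. -/
def subspaceOn (K : SSet.{u}) (P : Set (K _⦋0⦌)) : K.Subcomplex where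
  obj n := {σ | ∀ v : ⦋0⦌ ⟶ n.unop, K.map v.op σ ∈ P}
  map {n m} f σ hσ v := by
    have := hσ (v ≫ f.unop)
    simpa using this

end SSet

/-- A *simplicial space*: a simplicial object in simplicial sets. For `X : SimplicialSpace`, the
simplicial set `X _⦋n⦌` is the `n`-th space of `X`. -/
abbrev SimplicialSpace : Type (u + 1) := SimplicialObject SSet.{u}

namespace SimplicialSpace

open SSet

/-! ### The two embeddings of simplicial sets and mapping spaces -/

/-- The embedding `S ↦ (k, l) ↦ S_k` of simplicial sets as levelwise discrete simplicial spaces. -/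
def discreteEmb : SSet.{u} ⥤ SimplicialSpace.{u} :=
  (Functor.whiskeringRight _ _ _).obj (Functor.const SimplexCategoryᵒᵖ)

/-- The embedding `S ↦ (k, l) ↦ S_l` of simplicial sets as constant simplicial spaces. -/
def constantEmb : SSet.{u} ⥤ SimplicialSpace.{u} := Functor.const SimplexCategoryᵒᵖ

/-- The cosimplicial simplicial space `n ↦ F(n)`. -/
def F : SimplexCategory ⥤ SimplicialSpace.{u} := SSet.stdSimplex ⋙ discreteEmb

/-- The boundary inclusion `∂F(n) ⟶ F(n)`. -/
def boundaryInclusion (n : ℕ) :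
    discreteEmb.{u}.obj (∂Δ[n] : SSet.{u}) ⟶ F.obj ⦋n⦌ :=
  discreteEmb.map ∂Δ[n].ι

/-- The spine of `Δ[n]`: the subcomplex generated by the edges `i ⟶ i + 1`. -/
def spine (n : ℕ) : (Δ[n] : SSet.{u}).Subcomplex :=
  ⨆ i : Fin n, Subcomplex.ofSimplex (SSet.stdSimplex.objEquiv.symm (SimplexCategory.mkOfSucc i))

/-- The spine inclusion `G(n) ⟶ F(n)`. -/
def spineInclusion (n : ℕ) :
    discreteEmb.{u}.obj (spine n : SSet.{u}) ⟶ F.obj ⦋n⦌ :=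
  discreteEmb.map (spine n).ι

/-- The mapping space `Map(A, X)`, with `Map(A, X)_l = Hom(A × Δ[l], X)`. -/
def Map (A X : SimplicialSpace.{u}) : SSet.{u} where
  obj l := A ⊗ constantEmb.obj (SSet.stdSimplex.obj l.unop) ⟶ X
  map g := ↾fun φ ↦ A ◁ constantEmb.map (SSet.stdSimplex.map g.unop) ≫ φ
  map_id l := by
    refine ConcreteCategory.hom_ext _ _ fun φ ↦ ?_
    have h := (SSet.stdSimplex ⋙ constantEmb ⋙ tensorLeft A).map_id l.unop
    exact (congrArg (· ≫ φ) h).trans (Category.id_comp _)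
  map_comp g h := by
    refine ConcreteCategory.hom_ext _ _ fun φ ↦ ?_
    have e := (SSet.stdSimplex ⋙ constantEmb ⋙ tensorLeft A).map_comp h.unop g.unop
    exact (congrArg (· ≫ φ) e).trans (Category.assoc _ _ _)

/-- Restriction of maps along `f : A ⟶ B`. -/
def Map.precomp {A B : SimplicialSpace.{u}} (f : A ⟶ B) (X : SimplicialSpace.{u}) :
    Map B X ⟶ Map A X where
  app l := ↾fun φ ↦ f ▷ constantEmb.obj (SSet.stdSimplex.obj l.unop) ≫ φ
  naturality l m g := by
    ext φ
    exact (whisker_exchange_assoc f (constantEmb.map (SSet.stdSimplex.map g.unop)) φ).symm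

/-- The exponential `Y ^ X`, with `(Y ^ X)_{n l} = Hom(F(n) × X × Δ[l], Y)`. -/
def exp (Y X : SimplicialSpace.{u}) : SimplicialSpace.{u} where
  obj n := Map (F.obj n.unop ⊗ X) Y
  map f := Map.precomp (F.map f.unop ▷ X) Y
  map_id n := by
    ext l φ
    change (F.map (𝟙 n.unop) ▷ X) ▷ constantEmb.obj (SSet.stdSimplex.obj l.unop) ≫ φ = φ
    simp only [CategoryTheory.Functor.map_id, id_whiskerRight]
    exact Category.id_comp _
  map_comp {n m k} f g := by
    ext l φ
    change (F.map (g.unop ≫ f.unop) ▷ X) ▷ constantEmb.obj (SSet.stdSimplex.obj l.unop) ≫ φ =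
      (F.map g.unop ▷ X) ▷ constantEmb.obj (SSet.stdSimplex.obj l.unop) ≫
        (F.map f.unop ▷ X) ▷ constantEmb.obj (SSet.stdSimplex.obj l.unop) ≫ φ
    simp only [Functor.map_comp, comp_whiskerRight]
    exact Category.assoc _ _ _

/-! ### Reedy fibrant simplicial spaces and Segal spaces -/

/-- `X` is *Reedy fibrant* if each `Map(F(n), X) ⟶ Map(∂F(n), X)` is a Kan fibration. -/
def IsReedyFibrant (X : SimplicialSpace.{u}) : Prop :=
  ∀ n : ℕ, IsKanFibration (Map.precomp (boundaryInclusion n) X)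

/-- A *Segal space* is a Reedy fibrant simplicial space `T` such that the maps
`T_n ≅ Map(F(n), T) ⟶ Map(G(n), T) ≅ T_1 ×_{T_0} ⋯ ×_{T_0} T_1`, `n ≥ 2`, are equivalences. -/
structure IsSegal (T : SimplicialSpace.{u}) : Prop where
  reedyFibrant : T.IsReedyFibrant
  segal : ∀ n : ℕ, 2 ≤ n → IsSpaceEquiv (Map.precomp (spineInclusion n) T)

/-- A map of (Reedy fibrant) simplicial spaces is an *equivalence* if it is one levelwise. -/
def IsLevelwiseEquiv {X Y : SimplicialSpace.{u}} (f : X ⟶ Y) : Prop :=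
  ∀ n : ℕ, IsSpaceEquiv (f.app (op ⦋n⦌))

/-! ### Objects, morphisms and homotopy equivalences -/

/-- The objects of `T` are the points of `T_0`. -/
abbrev Ob (T : SimplicialSpace.{u}) : Type u := (T _⦋0⦌) _⦋0⦌

/-- The source map `T_1 ⟶ T_0`, restriction to the vertex `0` of `[1]`. -/
abbrev src (T : SimplicialSpace.{u}) : T _⦋1⦌ ⟶ T _⦋0⦌ := T.δ 1

/-- The target map `T_1 ⟶ T_0`, restriction to the vertex `1` of `[1]`. -/
abbrev tgt (T : SimplicialSpace.{u}) : T _⦋1⦌ ⟶ T _⦋0⦌ := T.δ 0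

/-- The mapping space `map_T(x, y)`: the fibre of `(src, tgt) : T_1 ⟶ T_0 × T_0` over `(x, y)`. -/
def mapSpace (T : SimplicialSpace.{u}) (x y : T.Ob) : (T _⦋1⦌).Subcomplex :=
  fibre T.src x ⊓ fibre T.tgt y

/-- The morphisms `x ⟶ y` are the points of `map_T(x, y)`. -/
abbrev Mor (T : SimplicialSpace.{u}) (x y : T.Ob) : Type u := (T.mapSpace x y : SSet.{u}) _⦋0⦌

lemma mem_fibre_zero {K L : SSet.{u}} (p : K ⟶ L) (a : K _⦋0⦌) :
    a ∈ (fibre p (p.app (op ⦋0⦌) a)).obj (op ⦋0⦌) :=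
  Subcomplex.mem_ofSimplex_obj _

/-- A point of `T_1`, as a morphism from its source to its target. -/
def morOfPoint (T : SimplicialSpace.{u}) (f : (T _⦋1⦌) _⦋0⦌) :
    T.Mor (T.src.app _ f) (T.tgt.app _ f) :=
  ⟨f, mem_fibre_zero _ _, mem_fibre_zero _ _⟩

/-- The point `id_x = s_0 x` of `T_1`. -/
def idPoint (T : SimplicialSpace.{u}) (x : T.Ob) : (T _⦋1⦌) _⦋0⦌ :=
  (T.σ (0 : Fin 1)).app _ x

lemma src_idPoint (T : SimplicialSpace.{u}) (x : T.Ob) : T.src.app _ (T.idPoint x) = x := by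
  have := congrArg (fun φ ↦ φ.app (op ⦋0⦌) x) (T.δ_comp_σ_succ (i := (0 : Fin 1)))
  exact this

lemma tgt_idPoint (T : SimplicialSpace.{u}) (x : T.Ob) : T.tgt.app _ (T.idPoint x) = x := by
  have := congrArg (fun φ ↦ φ.app (op ⦋0⦌) x) (T.δ_comp_σ_self (i := (0 : Fin 1)))
  exact this

/-- The identity morphism of `x`. -/
def idMor (T : SimplicialSpace.{u}) (x : T.Ob) : T.Mor x x :=
  ⟨T.idPoint x, by
    have h := mem_fibre_zero T.src (T.idPoint x)
    rwa [src_idPoint] at h, by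
    have h := mem_fibre_zero T.tgt (T.idPoint x)
    rwa [tgt_idPoint] at h⟩

/-- `k` is a composite of `f` followed by `g`: there is a point of `T_2` whose edges `01`, `12`,
`02` are `f`, `g`, `k`. -/
def IsComposite (T : SimplicialSpace.{u}) {x y z : T.Ob} (f : T.Mor x y) (g : T.Mor y z)
    (k : T.Mor x z) : Prop :=
  ∃ ν : (T _⦋2⦌) _⦋0⦌, (T.δ (2 : Fin 3)).app _ ν = f.1 ∧ (T.δ (0 : Fin 3)).app _ ν = g.1 ∧
    (T.δ (1 : Fin 3)).app _ ν = k.1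

/-- Morphisms are homotopic if they are homotopic as points of the mapping space. -/
def MorHomotopic (T : SimplicialSpace.{u}) {x y : T.Ob} (f g : T.Mor x y) : Prop :=
  PointsHomotopic (T.mapSpace x y : SSet.{u}) f g

/-- `f : x ⟶ y` is a *homotopy equivalence* if there are `g, h : y ⟶ x` with `g ∘ f ∼ id_x` and
`f ∘ h ∼ id_y`. -/
def IsHoequiv (T : SimplicialSpace.{u}) {x y : T.Ob} (f : T.Mor x y) : Prop :=
  (∃ (g : T.Mor y x) (k : T.Mor x x), T.IsComposite f g k ∧ T.MorHomotopic k (T.idMor x)) ∧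
    ∃ (h : T.Mor y x) (k : T.Mor y y), T.IsComposite h f k ∧ T.MorHomotopic k (T.idMor y)

/-- The space `T_hoequiv` of homotopy equivalences, a subspace of `T_1`. -/
def hoequiv (T : SimplicialSpace.{u}) : (T _⦋1⦌).Subcomplex :=
  subspaceOn (T _⦋1⦌) {f | T.IsHoequiv (T.morOfPoint f)}

lemma _root_.SSet.PointsHomotopic.refl (K : SSet.{u}) (a : K _⦋0⦌) : PointsHomotopic K a a := by
  refine ⟨K.σ 0 a, ?_, ?_⟩
  · exact congrArg (fun φ ↦ φ a) (K.δ_comp_σ_succ (i := (0 : Fin 1)))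
  · exact congrArg (fun φ ↦ φ a) (K.δ_comp_σ_self (i := (0 : Fin 1)))

lemma isComposite_idMor (T : SimplicialSpace.{u}) (x : T.Ob) :
    T.IsComposite (T.idMor x) (T.idMor x) (T.idMor x) := by
  have key (i : Fin 3) : (T.δ i).app (op ⦋0⦌)
      ((T.map (SimplexCategory.const ⦋2⦌ ⦋0⦌ 0).op).app (op ⦋0⦌) x) = T.idPoint x := by
    have h : T.map (SimplexCategory.const ⦋2⦌ ⦋0⦌ 0).op ≫ T.δ i = T.σ (0 : Fin 1) := by
      refine (T.map_comp _ _).symm.trans (congrArg T.map ?_)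
      exact congrArg Quiver.Hom.op
        ((SimplexCategory.eq_const_to_zero _).trans (SimplexCategory.eq_const_to_zero _).symm)
    exact congrArg (fun φ ↦ φ.app (op ⦋0⦌) x) h
  exact ⟨_, key 2, key 0, key 1⟩

lemma isHoequiv_of_eq_idPoint (T : SimplicialSpace.{u}) {x y z : T.Ob} (hx : x = z) (hy : y = z)
    (f : T.Mor x y) (hf : f.1 = T.idPoint z) : T.IsHoequiv f := by
  subst hx hy
  obtain rfl : f = T.idMor y := Subtype.ext hf
  exact ⟨⟨_, _, T.isComposite_idMor y, .refl _ _⟩, ⟨_, _, T.isComposite_idMor y, .refl _ _⟩⟩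

lemma range_degeneracy_le (T : SimplicialSpace.{u}) :
    Subcomplex.range (T.σ (0 : Fin 1)) ≤ T.hoequiv := by
  rintro n _ ⟨y, rfl⟩ v
  have h : (T _⦋1⦌).map v.op ((T.σ (0 : Fin 1)).app n y) = T.idPoint ((T _⦋0⦌).map v.op y) :=
    (NatTrans.naturality_apply (T.σ (0 : Fin 1)) v.op y).symm
  refine T.isHoequiv_of_eq_idPoint (z := (T _⦋0⦌).map v.op y) ?_ ?_ _ h
  · exact (congrArg _ h).trans (T.src_idPoint _)
  · exact (congrArg _ h).trans (T.tgt_idPoint _)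

/-- The map `s_0 : T_0 ⟶ T_hoequiv`. -/
def toHoequiv (T : SimplicialSpace.{u}) : T _⦋0⦌ ⟶ (T.hoequiv : SSet.{u}) :=
  Subcomplex.lift (T.σ (0 : Fin 1)) T.range_degeneracy_le

/-- A *complete Segal space*: a Segal space `W` for which `s_0 : W_0 ⟶ W_hoequiv` is an
equivalence. -/
structure IsCompleteSegal (W : SimplicialSpace.{u}) : Prop extends W.IsSegal where
  complete : IsSpaceEquiv W.toHoequiv

/-! ### Under-categories and initial objects -/

/-- The image in `X_{n l}` of a point `x` of `X_0` under the degeneracies. -/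
def degenerate (X : SimplicialSpace.{u}) (x : X.Ob) (n l : SimplexCategoryᵒᵖ) :
    (X.obj n).obj l :=
  (X.map (SimplexCategory.const n.unop ⦋0⦌ 0).op).app l
    ((X _⦋0⦌).map (SimplexCategory.const l.unop ⦋0⦌ 0).op x)

lemma degenerate_naturality_left (X : SimplicialSpace.{u}) (x : X.Ob) {n m : SimplexCategoryᵒᵖ}
    (l : SimplexCategoryᵒᵖ) (f : n ⟶ m) :
    (X.map f).app l (X.degenerate x n l) = X.degenerate x m l := by
  have h : X.map (SimplexCategory.const n.unop ⦋0⦌ 0).op ≫ X.map f =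
      X.map (SimplexCategory.const m.unop ⦋0⦌ 0).op :=
    (X.map_comp _ _).symm.trans (congrArg X.map (congrArg Quiver.Hom.op
      (SimplexCategory.eq_const_to_zero (f.unop ≫ SimplexCategory.const n.unop ⦋0⦌ 0))))
  exact congrArg (fun φ ↦ φ.app l ((X _⦋0⦌).map (SimplexCategory.const l.unop ⦋0⦌ 0).op x)) h

lemma degenerate_naturality_right (X : SimplicialSpace.{u}) (x : X.Ob) (n : SimplexCategoryᵒᵖ)
    {l k : SimplexCategoryᵒᵖ} (g : l ⟶ k) :
    (X.obj n).map g (X.degenerate x n l) = X.degenerate x n k := by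
  have h : (X _⦋0⦌).map (SimplexCategory.const l.unop ⦋0⦌ 0).op ≫ (X _⦋0⦌).map g =
      (X _⦋0⦌).map (SimplexCategory.const k.unop ⦋0⦌ 0).op :=
    ((X _⦋0⦌).map_comp _ _).symm.trans (congrArg (X _⦋0⦌).map (congrArg Quiver.Hom.op
      (SimplexCategory.eq_const_to_zero (g.unop ≫ SimplexCategory.const l.unop ⦋0⦌ 0))))
  refine (NatTrans.naturality_apply (X.map (SimplexCategory.const n.unop ⦋0⦌ 0).op) g _).symm.trans
    ?_
  exact congrArg ((X.map (SimplexCategory.const n.unop ⦋0⦌ 0).op).app k)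
    (congrArg (fun φ ↦ φ x) h)

/-- The simplex `(id_[n], a, id_[l])` of `F(n) × A × Δ[l]` in bidegree `(n, l)`. -/
def evalPoint (A : SimplicialSpace.{u}) (a : A.Ob) (n l : SimplexCategoryᵒᵖ) :
    (((F.obj n.unop ⊗ A) ⊗ constantEmb.obj (SSet.stdSimplex.obj l.unop)).obj n).obj l :=
  let i : (SSet.stdSimplex.{u}.obj n.unop).obj n := SSet.stdSimplex.objEquiv.symm (𝟙 n.unop)
  let j : (SSet.stdSimplex.{u}.obj l.unop).obj l := SSet.stdSimplex.objEquiv.symm (𝟙 l.unop)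
  ((i, A.degenerate a n l), j)

/-- The value of `φ : F(n) × A × Δ[l] ⟶ Y` at `(id_[n], a, id_[l])`. -/
def evalSimplex {Y A : SimplicialSpace.{u}} (a : A.Ob) (n l : SimplexCategoryᵒᵖ)
    (φ : (F.obj n.unop ⊗ A) ⊗ constantEmb.obj (SSet.stdSimplex.obj l.unop) ⟶ Y) :
    (Y.obj n).obj l :=
  (φ.app n).app l (A.evalPoint a n l)

/-- Evaluation `Y ^ A ⟶ Y` at an object `a` of `A`: it sends `φ : F(n) × A × Δ[l] ⟶ Y` to
`φ(id_[n], a, id_[l])`. -/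
def evalAt (Y A : SimplicialSpace.{u}) (a : A.Ob) : Y.exp A ⟶ Y where
  app n :=
    { app l := ↾fun φ ↦ evalSimplex a n l φ
      naturality l k g := by
        refine ConcreteCategory.hom_ext _ _ fun
          (φ : (F.obj n.unop ⊗ A) ⊗ constantEmb.obj (SSet.stdSimplex.obj l.unop) ⟶ Y) ↦ ?_
        refine Eq.trans ?_ (NatTrans.naturality_apply (φ.app n) g (A.evalPoint a n l))
        refine congrArg ((φ.app n).app k) ?_
        refine Prod.ext (Prod.ext rfl (A.degenerate_naturality_right a n g).symm) ?_
        exact congrArg SSet.stdSimplex.objEquiv.symm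
          ((Category.id_comp g.unop).trans (Category.comp_id g.unop).symm) }
  naturality n m f := by
    refine SSet.hom_ext fun l ↦ ConcreteCategory.hom_ext _ _ fun
      (φ : (F.obj n.unop ⊗ A) ⊗ constantEmb.obj (SSet.stdSimplex.obj l.unop) ⟶ Y) ↦ ?_
    refine Eq.trans ?_ (congrArg (fun ψ ↦ ψ.app l (A.evalPoint a n l)) (φ.naturality f))
    refine congrArg ((φ.app m).app l) ?_
    refine Prod.ext (Prod.ext ?_ (A.degenerate_naturality_left a l f).symm) rfl
    exact congrArg SSet.stdSimplex.objEquiv.symm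
      ((Category.id_comp f.unop).trans (Category.comp_id f.unop).symm)

/-- The objects `0` and `1` of `F(1)`. -/
def F1Vertex (i : Fin 2) : (F.{u}.obj ⦋1⦌).Ob :=
  SSet.stdSimplex.objEquiv.symm (SimplexCategory.const ⦋0⦌ ⦋1⦌ i)

/-- The source map `W ^ F(1) ⟶ W`. -/
def expSrc (W : SimplicialSpace.{u}) : W.exp (F.obj ⦋1⦌) ⟶ W := W.evalAt _ (F1Vertex 0)

/-- The target map `W ^ F(1) ⟶ W`. -/
def expTgt (W : SimplicialSpace.{u}) : W.exp (F.obj ⦋1⦌) ⟶ W := W.evalAt _ (F1Vertex 1)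

/-- The `n`-th space of the fibre of `p : Y ⟶ X` over an object `x` of `X`. -/
def fibreOverLevel {Y X : SimplicialSpace.{u}} (p : Y ⟶ X) (x : X.Ob) (n : SimplexCategoryᵒᵖ) :
    (Y.obj n).Subcomplex where
  obj l := {σ | (p.app n).app l σ = X.degenerate x n l}
  map {l k} g σ hσ := by
    refine (NatTrans.naturality_apply (p.app n) g σ).trans ?_
    exact (congrArg ((X.obj n).map g) hσ).trans (X.degenerate_naturality_right x n g)

lemma map_mem_fibreOverLevel {Y X : SimplicialSpace.{u}} (p : Y ⟶ X) (x : X.Ob)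
    {n m : SimplexCategoryᵒᵖ} (f : n ⟶ m) {l : SimplexCategoryᵒᵖ} {σ : (Y.obj n).obj l}
    (hσ : σ ∈ (fibreOverLevel p x n).obj l) :
    (Y.map f).app l σ ∈ (fibreOverLevel p x m).obj l := by
  refine (congrArg (fun φ ↦ φ.app l σ) (p.naturality f)).trans ?_
  exact (congrArg ((X.map f).app l) hσ).trans (X.degenerate_naturality_left x l f)

/-- The fibre `F(0) ×_X Y` of `p : Y ⟶ X` over an object `x : F(0) ⟶ X`: the simplices of `Y` that
are sent to a degeneracy of `x`. -/
def fibreOver {Y X : SimplicialSpace.{u}} (p : Y ⟶ X) (x : X.Ob) : SimplicialSpace.{u} where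
  obj n := (fibreOverLevel p x n : SSet.{u})
  map f := Subcomplex.lift ((fibreOverLevel p x _).ι ≫ Y.map f) (by
    rintro l _ ⟨⟨σ, hσ⟩, rfl⟩
    exact map_mem_fibreOverLevel p x f hσ)
  map_id n := by
    refine SSet.hom_ext fun l ↦ ConcreteCategory.hom_ext _ _ fun σ ↦ Subtype.ext ?_
    exact congrArg (fun φ ↦ φ.app l σ.1) (Y.map_id n)
  map_comp f g := by
    refine SSet.hom_ext fun l ↦ ConcreteCategory.hom_ext _ _ fun σ ↦ Subtype.ext ?_
    exact congrArg (fun φ ↦ φ.app l σ.1) (Y.map_comp f g)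

/-- The inclusion of the fibre. -/
def fibreOverInclusion {Y X : SimplicialSpace.{u}} (p : Y ⟶ X) (x : X.Ob) : fibreOver p x ⟶ Y where
  app n := (fibreOverLevel p x n).ι
  naturality _ _ _ := rfl

/-- The under-category `W_{x/} = F(0) ×_W W ^ F(1)`, the fibre of the source map over `x`. -/
def under (W : SimplicialSpace.{u}) (x : W.Ob) : SimplicialSpace.{u} := fibreOver W.expSrc x

/-- The projection `W_{x/} ⟶ W`, which remembers the target. -/
def underProj (W : SimplicialSpace.{u}) (x : W.Ob) : W.under x ⟶ W :=
  fibreOverInclusion W.expSrc x ≫ W.expTgt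

/-- The object `x` is *initial* if the projection `W_{x/} ⟶ W` is an equivalence. -/
def IsInitialOb (W : SimplicialSpace.{u}) (x : W.Ob) : Prop := IsLevelwiseEquiv (W.underProj x)

/-- The space of initial objects `W_init`, the subspace of `W_0` generated by the initial
objects. -/
def init (W : SimplicialSpace.{u}) : (W _⦋0⦌).Subcomplex :=
  subspaceOn (W _⦋0⦌) {x | W.IsInitialOb x}

end SimplicialSpace

/-! ### Homotopies between maps into Kan complexes -/

namespace SSet

open CartesianMonoidalCategory Limits modelCategoryQuillen

/-! Reedy fibrancy makes (source, target) : W^F(1) ⟶ W × W a levelwise Kan fibration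
(`IsReedyFibrant.fibration_expSrc_expTgt`). Hence the projection W_{x/} ⟶ W is a levelwise Kan
fibration, and `x` is initial exactly when it is levelwise a trivial fibration (`isInitialOb_iff`).
This lifting property is carried along paths in W_0 (`rlp_boundary_constFibre_of_path`), so W_init
is closed under paths and is therefore a Kan complex (`kanComplex_subspaceOn`).

Suppose that `x` is initial. In level 0, the trivial fibration lets the inclusion W_init ⟶ W_0 be
lifted to a family u : W_init ⟶ W_1 of arrows from `x` to the varying initial object
(`IsInitialOb.exists_family`). An arrow between initial objects is a homotopy equivalence: there is
an arrow back, composites exist by the Segal condition, and parallel arrows out of an initial object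
are homotopic (`IsInitialOb.morHomotopic`). So u lands in W_hoequiv. By completeness, source and
target are homotopic on W_hoequiv (`IsCompleteSegal.mapsHomotopic_src_tgt`); restricting along u
gives a homotopy from the constant map at `x` to the inclusion. Its vertices all lie at its two
ends, so it stays in W_init and contracts W_init onto `x`. -/

lemma whiskerLeft_δ_one (A : SSet.{u}) :
    A ◁ stdSimplex.δ (1 : Fin 2) = fst A Δ[0] ≫ ι₀ := by
  refine CartesianMonoidalCategory.hom_ext _ _ (by simp) ?_
  rw [CartesianMonoidalCategory.whiskerLeft_snd, stdSimplex.δ_one_eq_const]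
  rfl

lemma whiskerLeft_δ_zero (A : SSet.{u}) :
    A ◁ stdSimplex.δ (0 : Fin 2) = fst A Δ[0] ≫ ι₁ := by
  refine CartesianMonoidalCategory.hom_ext _ _ (by simp) ?_
  rw [CartesianMonoidalCategory.whiskerLeft_snd, stdSimplex.δ_zero_eq_const]
  rfl

lemma cancel_fst_point {A X : SSet.{u}} {f g : A ⟶ X}
    (h : fst A Δ[0] ≫ f = fst A Δ[0] ≫ g) : f = g := by
  have := lift (𝟙 A) A.toPoint ≫= h
  simpa using this

/-- Two homotopies with the same end and the same image under a Kan fibration can be composed to a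
fibrewise homotopy between their starts. -/
lemma exists_fibrewise_homotopy {A X Y : SSet.{u}} (p : X ⟶ Y) [Fibration p]
    (H K : A ⊗ Δ[1] ⟶ X) (h₁ : ι₁ ≫ H = ι₁ ≫ K) (hp : H ≫ p = K ≫ p) :
    ∃ L : A ⊗ Δ[1] ⟶ X, ι₀ ≫ L = ι₀ ≫ H ∧ ι₁ ≫ L = ι₀ ≫ K ∧
      L ≫ p = fst A Δ[1] ≫ ι₀ ≫ H ≫ p := by
  -- This is a horn Λ[2, 2] in the internal hom, with `K` on the edge 12 and `H` on the edge 02. The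
  -- edge 01 of a filler is the desired `L`.
  let f : ∀ (j : Fin 3) (_ : j ≠ 2), Δ[1] ⟶ (ihom A).obj X := fun j _ ↦
    MonoidalClosed.curry (if j = 0 then K else H)
  have hf : horn.IsCompatible f := by
    rw [horn.isCompatible_iff]
    intro j k hj hk hjk
    obtain rfl : j = 0 := by grind
    obtain rfl : k = 1 := by grind
    simp only [f]
    apply MonoidalClosed.uncurry_injective
    change MonoidalClosed.uncurry (stdSimplex.δ 0 ≫ _) = MonoidalClosed.uncurry (stdSimplex.δ 0 ≫ _)
    rw [MonoidalClosed.uncurry_natural_left, MonoidalClosed.uncurry_natural_left,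
      MonoidalClosed.uncurry_curry, MonoidalClosed.uncurry_curry, whiskerLeft_δ_zero]
    simp [h₁]
  -- The filler is taken over the degenerate triangle `σ 0` of `H ≫ p`, whose edge 01 is constant;
  -- this makes `L` fibrewise.
  obtain ⟨T, hT, hTp⟩ := hf.exists_lift ((ihom A).map p)
    (MonoidalClosed.curry (A ◁ stdSimplex.σ (0 : Fin 2) ≫ H ≫ p)) (by
      intro j hj
      apply MonoidalClosed.uncurry_injective
      rw [← MonoidalClosed.curry_natural_right, MonoidalClosed.uncurry_curry,
        MonoidalClosed.uncurry_natural_left, MonoidalClosed.uncurry_curry,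
        ← MonoidalCategory.whiskerLeft_comp_assoc]
      obtain rfl | rfl : j = 0 ∨ j = 1 := by grind
      · have : (stdSimplex.δ (0 : Fin 3) ≫ stdSimplex.σ (0 : Fin 2) : Δ[1] ⟶ Δ[1]) = 𝟙 Δ[1] :=
          stdSimplex.δ_comp_σ_self (i := (0 : Fin 2))
        rw [this]; simp [hp]
      · have : (stdSimplex.δ (1 : Fin 3) ≫ stdSimplex.σ (0 : Fin 2) : Δ[1] ⟶ Δ[1]) = 𝟙 Δ[1] :=
          stdSimplex.δ_comp_σ_succ (i := (0 : Fin 2))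
        rw [this]; simp)
  have e0 : (stdSimplex.δ (0 : Fin 2) ≫ stdSimplex.δ (2 : Fin 3) : Δ[0] ⟶ Δ[2]) =
      stdSimplex.δ (1 : Fin 2) ≫ stdSimplex.δ (0 : Fin 3) :=
    stdSimplex.δ_comp_δ (n := 0) (i := 0) (j := 1) (by simp)
  have e1 : (stdSimplex.δ (1 : Fin 2) ≫ stdSimplex.δ (2 : Fin 3) : Δ[0] ⟶ Δ[2]) =
      stdSimplex.δ (1 : Fin 2) ≫ stdSimplex.δ (1 : Fin 3) :=
    stdSimplex.δ_comp_δ (n := 0) (i := 1) (j := 1) (by simp)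
  have e2 : (stdSimplex.δ (2 : Fin 3) ≫ stdSimplex.σ (0 : Fin 2) : Δ[1] ⟶ Δ[1]) =
      stdSimplex.σ (0 : Fin 1) ≫ stdSimplex.δ (1 : Fin 2) :=
    stdSimplex.δ_comp_σ_of_gt (n := 0) (i := 1) (j := 0) (by simp)
  have hT0 := hT 0 (by decide)
  have hT1 := hT 1 (by decide)
  refine ⟨MonoidalClosed.uncurry (stdSimplex.δ 2 ≫ T), ?_, ?_, ?_⟩
  · apply cancel_fst_point
    rw [← Category.assoc, ← whiskerLeft_δ_one, ← MonoidalClosed.uncurry_natural_left,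
      reassoc_of% e1, hT1, ← Category.assoc (fst _ _), ← whiskerLeft_δ_one,
      MonoidalClosed.uncurry_natural_left]
    simp [f]
  · apply cancel_fst_point
    rw [← Category.assoc, ← whiskerLeft_δ_zero, ← MonoidalClosed.uncurry_natural_left,
      reassoc_of% e0, hT0, ← Category.assoc (fst _ _), ← whiskerLeft_δ_one,
      MonoidalClosed.uncurry_natural_left]
    simp [f]
  · rw [← MonoidalClosed.uncurry_natural_right, Category.assoc, hTp,
      MonoidalClosed.uncurry_natural_left, MonoidalClosed.uncurry_curry,
      ← MonoidalCategory.whiskerLeft_comp_assoc, e2, MonoidalCategory.whiskerLeft_comp_assoc,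
      ← Category.assoc (A ◁ stdSimplex.δ 1), whiskerLeft_δ_one]
    simp

/-- Two maps are *homotopic* if there is a homotopy from the first to the second. -/
def MapsHomotopic {A X : SSet.{u}} (f g : A ⟶ X) : Prop := Nonempty (Homotopy f g)

/-- A homotopy, given by a map out of the cylinder. -/
lemma MapsHomotopic.mk {A X : SSet.{u}} {f g : A ⟶ X} (H : A ⊗ Δ[1] ⟶ X) (h₀ : ι₀ ≫ H = f)
    (h₁ : ι₁ ≫ H = g) : MapsHomotopic f g :=
  ⟨{ h := H, h₀ := h₀, h₁ := h₁, rel := by ext _ ⟨x, _⟩ ; exact x.2.elim }⟩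

lemma MapsHomotopic.exists_cylinder {A X : SSet.{u}} {f g : A ⟶ X} (h : MapsHomotopic f g) :
    ∃ H : A ⊗ Δ[1] ⟶ X, ι₀ ≫ H = f ∧ ι₁ ≫ H = g := by
  obtain ⟨H⟩ := h
  exact ⟨H.h, H.h₀, H.h₁⟩

lemma MapsHomotopic.refl {A X : SSet.{u}} (f : A ⟶ X) : MapsHomotopic f f :=
  .mk (fst _ _ ≫ f) (by simp) (by simp)

/-- The constant homotopy at the end of `H` and `H` itself share their end, so they compose to a
homotopy between their starts. -/
lemma MapsHomotopic.symm {A X : SSet.{u}} [KanComplex X] {f g : A ⟶ X} (h : MapsHomotopic f g) :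
    MapsHomotopic g f := by
  obtain ⟨H, rfl, rfl⟩ := h.exists_cylinder
  obtain ⟨L, h₀, h₁, -⟩ := exists_fibrewise_homotopy (terminal.from X) (fst _ _ ≫ ι₁ ≫ H) H
    (by simp) (by subsingleton)
  exact .mk L (by simpa using h₀) h₁

lemma MapsHomotopic.trans {A X : SSet.{u}} [KanComplex X] {f g k : A ⟶ X}
    (h : MapsHomotopic f g) (h' : MapsHomotopic g k) : MapsHomotopic f k := by
  obtain ⟨H, rfl, rfl⟩ := h.exists_cylinder
  obtain ⟨H', h₀', h₁'⟩ := h'.symm.exists_cylinder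
  obtain ⟨L, h₀, h₁, -⟩ := exists_fibrewise_homotopy (terminal.from X) H H' h₁'.symm (by subsingleton)
  exact .mk L h₀ (by rw [h₁, h₀'])

lemma MapsHomotopic.precomp {A B X : SSet.{u}} {f g : B ⟶ X} (h : MapsHomotopic f g) (i : A ⟶ B) :
    MapsHomotopic (i ≫ f) (i ≫ g) := by
  obtain ⟨H, rfl, rfl⟩ := h.exists_cylinder
  exact .mk (i ▷ _ ≫ H) (by simp) (by simp)

lemma MapsHomotopic.postcomp {A B X : SSet.{u}} {f g : A ⟶ B} (h : MapsHomotopic f g) (i : B ⟶ X) :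
    MapsHomotopic (f ≫ i) (g ≫ i) := by
  obtain ⟨H, rfl, rfl⟩ := h.exists_cylinder
  exact .mk (H ≫ i) (by simp) (by simp)

end SSet

/-! ### Homotopy lifting and trivial fibrations -/

namespace SSet

open CartesianMonoidalCategory Limits modelCategoryQuillen

/-- The inclusion of the end `e` of a cylinder. -/
noncomputable def cylinderEnd (X : SSet.{u}) (e : Fin 2) : X ⟶ X ⊗ Δ[1] :=
  lift (𝟙 X) (const (stdSimplex.obj₀Equiv.{u}.symm e))

@[simp]
lemma cylinderEnd_fst_assoc {X Z : SSet.{u}} (e : Fin 2) (h : X ⟶ Z) :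
    cylinderEnd X e ≫ fst X _ ≫ h = h := rfl

@[simp]
lemma cylinderEnd_snd_assoc {X Z : SSet.{u}} (e : Fin 2) (h : Δ[1] ⟶ Z) :
    cylinderEnd X e ≫ snd X _ ≫ h = const (stdSimplex.obj₀Equiv.{u}.symm e) ≫ h := rfl

lemma cylinderEnd_naturality_assoc {X Y Z : SSet.{u}} (f : X ⟶ Y) (e : Fin 2)
    (h : Y ⊗ Δ[1] ⟶ Z) :
    f ≫ cylinderEnd Y e ≫ h = cylinderEnd X e ≫ f ▷ Δ[1] ≫ h := rfl

lemma cylinderEnd_zero (X : SSet.{u}) : cylinderEnd X 0 = ι₀ := rfl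

lemma cylinderEnd_one (X : SSet.{u}) : cylinderEnd X 1 = ι₁ := rfl

lemma whiskerLeft_δ_rev (A : SSet.{u}) (e : Fin 2) :
    A ◁ stdSimplex.δ e.rev = fst A Δ[0] ≫ cylinderEnd A e := by
  fin_cases e
  · exact whiskerLeft_δ_one A
  · exact whiskerLeft_δ_zero A

/-- The horn `Λ[1, e]` is just the vertex `e`, which is the face opposite to `e.rev`. -/
lemma tensor_horn_one_hom_ext {A X : SSet.{u}} (e : Fin 2)
    {f g : A ⊗ (Λ[1, e] : SSet.{u}) ⟶ X}
    (h : A ◁ horn.ι e e.rev (by fin_cases e <;> decide) ≫ f =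
      A ◁ horn.ι e e.rev (by fin_cases e <;> decide) ≫ g) : f = g := by
  apply MonoidalClosed.curry_injective
  refine horn.hom_ext' fun j hj ↦ ?_
  obtain rfl : j = e.rev := (by decide : ∀ j e : Fin 2, j ≠ e → j = e.rev) j e hj
  rw [← MonoidalClosed.curry_natural_left, ← MonoidalClosed.curry_natural_left]
  exact congrArg _ h

/-- Homotopy lifting for Kan fibrations, relative to a subcomplex. -/
lemma exists_homotopy_lift {B X Y : SSet.{u}} (p : X ⟶ Y) [Fibration p] (A : B.Subcomplex)
    (e : Fin 2) (f : (A : SSet.{u}) ⊗ Δ[1] ⟶ X) (g : B ⟶ X) (h : B ⊗ Δ[1] ⟶ Y)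
    (hfg : cylinderEnd _ e ≫ f = A.ι ≫ g) (hf : f ≫ p = A.ι ▷ Δ[1] ≫ h)
    (hg : g ≫ p = cylinderEnd _ e ≫ h) :
    ∃ k : B ⊗ Δ[1] ⟶ X, A.ι ▷ Δ[1] ≫ k = f ∧ cylinderEnd _ e ≫ k = g ∧ k ≫ p = h := by
  have he : e.rev ≠ e := (by decide : ∀ e : Fin 2, e.rev ≠ e) e
  have hδ (C : SSet.{u}) : C ◁ horn.ι e e.rev he ≫ C ◁ Λ[1, e].ι = fst C Δ[0] ≫ cylinderEnd C e := by
    rw [← MonoidalCategory.whiskerLeft_comp, horn.ι_ι, whiskerLeft_δ_rev]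
  -- As `Λ[1, e]` is the vertex `e`, the union product is B × {e} ∪ A × Δ[1]: the prescribed data
  -- are exactly a map out of this pushout, and its inclusion into B × Δ[1] is anodyne.
  have hpo := Subcomplex.unionProd.isPushout A (Λ[1, e] : Δ[1].Subcomplex)
  have w : A.ι ▷ (Λ[1, e] : SSet.{u}) ≫ fst _ _ ≫ g = (A : SSet.{u}) ◁ Λ[1, e].ι ≫ f := by
    apply tensor_horn_one_hom_ext e
    rw [← Category.assoc (_ ◁ _) (_ ◁ _), hδ, Category.assoc, hfg]
    simp
  have sq : CommSq (hpo.desc (fst _ _ ≫ g) f w) (A.unionProd (Λ[1, e] : Δ[1].Subcomplex)).ι p h := by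
    refine ⟨hpo.hom_ext ?_ ?_⟩
    · rw [hpo.inl_desc_assoc, Subcomplex.unionProd.ι₁_ι_assoc]
      apply tensor_horn_one_hom_ext e
      rw [← Category.assoc (_ ◁ _) (_ ◁ _), hδ]
      simp [hg]
    · rw [hpo.inr_desc_assoc, Subcomplex.unionProd.ι₂_ι_assoc, hf]
  have : HasLiftingProperty (A.unionProd (Λ[1, e] : Δ[1].Subcomplex)).ι p :=
    anodyneExtensions_unionProd_ι A _ (anodyneExtensions.horn_ι e) p
      ((HomotopicalAlgebra.fibration_iff p).1 inferInstance)
  refine ⟨sq.lift, ?_, ?_, sq.fac_right⟩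
  · rw [← Subcomplex.unionProd.ι₂_ι_assoc, sq.fac_left, hpo.inr_desc]
  · apply cancel_fst_point
    rw [← Category.assoc, ← hδ, Category.assoc, ← Subcomplex.unionProd.ι₁_ι_assoc, sq.fac_left,
      hpo.inl_desc]
    simp

/-- Homotopy lifting for Kan fibrations. -/
lemma exists_homotopy_lift_absolute {B X Y : SSet.{u}} (p : X ⟶ Y) [Fibration p]
    (e : Fin 2) (g : B ⟶ X) (h : B ⊗ Δ[1] ⟶ Y) (hg : g ≫ p = cylinderEnd _ e ≫ h) :
    ∃ k : B ⊗ Δ[1] ⟶ X, cylinderEnd _ e ≫ k = g ∧ k ≫ p = h := by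
  obtain ⟨k, -, h₁, h₂⟩ := exists_homotopy_lift p (⊥ : B.Subcomplex) e
    (fst _ _ ≫ Subcomplex.ι _ ≫ g) g h (by simp) (by ext _ ⟨x, _⟩; exact x.2.elim) hg
  exact ⟨k, h₁, h₂⟩

/-- Lifting against boundary inclusions, spelled out. -/
lemma rlp_boundary_of_exists {X Y : SSet.{u}} (p : X ⟶ Y)
    (h : ∀ (n : ℕ) (a : (∂Δ[n] : SSet.{u}) ⟶ X) (b : Δ[n] ⟶ Y), a ≫ p = ∂Δ[n].ι ≫ b →
      ∃ l : Δ[n] ⟶ X, ∂Δ[n].ι ≫ l = a ∧ l ≫ p = b) : I.rlp p := by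
  rintro _ _ _ ⟨n⟩
  refine ⟨fun {f g} sq ↦ ?_⟩
  obtain ⟨l, h₁, h₂⟩ := h n f g sq.w
  exact ⟨⟨⟨l, h₁, h₂⟩⟩⟩

/-- Boundary inclusions generate all monomorphisms. The inclusion of the empty simplicial set yields
existence of lifts, and the two ends of a cylinder yield their uniqueness up to homotopy. -/
lemma exists_lift_of_rlp_boundary {X Y : SSet.{u}} {p : X ⟶ Y} (hp : I.rlp p) {A B : SSet.{u}}
    (i : A ⟶ B) [Mono i] (a : A ⟶ X) (b : B ⟶ Y) (w : a ≫ p = i ≫ b) :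
    ∃ l : B ⟶ X, i ≫ l = a ∧ l ≫ p = b := by
  rw [← rlp_monomorphisms] at hp
  have := hp i (MorphismProperty.monomorphisms.infer_property i)
  have sq : CommSq a i p b := ⟨w⟩
  exact ⟨sq.lift, sq.fac_left, sq.fac_right⟩

/-- A Kan fibration that is an equivalence has the right lifting property with respect to boundary
inclusions. -/
lemma rlp_boundary_of_isSpaceEquiv {X Y : SSet.{u}} [KanComplex X] (p : X ⟶ Y) [Fibration p]
    (hp : IsSpaceEquiv p) : I.rlp p := by
  obtain ⟨⟨g, hg⟩, ⟨h, hh⟩⟩ := hp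
  obtain ⟨G, hG₀, hG₁⟩ := MapsHomotopic.exists_cylinder hg
  -- Lifting the homotopy from `g ≫ p` to the identity, starting at `g`, replaces the homotopy
  -- section `g` by a strict section `s`.
  obtain ⟨S, hS₀, hS⟩ := exists_homotopy_lift_absolute p 0 g G hG₀.symm
  let s := cylinderEnd _ 1 ≫ S
  have hs : s ≫ p = 𝟙 Y := by
    simp only [s, Category.assoc, hS]
    exact hG₁
  have hh' : MapsHomotopic (p ≫ h) (𝟙 X) := hh
  have h₁ : MapsHomotopic (𝟙 X) (p ≫ s) := by
    refine hh'.symm.trans ?_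
    have := hh'.precomp (p ≫ s)
    simpa [reassoc_of% hs] using this
  obtain ⟨H, hH₀, hH₁⟩ := h₁.exists_cylinder
  -- `H` and `H ≫ p ≫ s` both end at `p ≫ s` and agree after `p`, so `L` is a homotopy over `Y` from
  -- the identity to `p ≫ s`.
  obtain ⟨L, hL₀, hL₁, hL⟩ := exists_fibrewise_homotopy p H (H ≫ p ≫ s)
    (by rw [reassoc_of% hH₁, hH₁, reassoc_of% hs]) (by simp [hs])
  rw [hH₀] at hL₀
  rw [reassoc_of% hH₀] at hL₁ hL
  refine rlp_boundary_of_exists p fun n a b w ↦ ?_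
  -- The simplex `b ≫ s` lies over `b` but has boundary `a ≫ p ≫ s`. Pushing it backwards along `L`,
  -- relative to the boundary, corrects this to `a`.
  obtain ⟨k, hk₁, hk₂, hk₃⟩ := exists_homotopy_lift p ∂Δ[n] 1 (a ▷ Δ[1] ≫ L) (b ≫ s) (fst _ _ ≫ b)
    (by
      rw [← cylinderEnd_naturality_assoc, cylinderEnd_one, hL₁, reassoc_of% w])
    (by simp [hL, w]) (by simp [hs])
  refine ⟨cylinderEnd _ 0 ≫ k, ?_, ?_⟩
  · rw [cylinderEnd_naturality_assoc, hk₁, ← cylinderEnd_naturality_assoc, cylinderEnd_zero, hL₀,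
      Category.comp_id]
  · simp [hk₃]

/-- Two disjoint copies of a simplicial set. -/
def double (X : SSet.{u}) : SSet.{u} where
  obj n := X.obj n ⊕ X.obj n
  map f := ↾(Sum.map (X.map f) (X.map f))
  map_id n := by ext (x | x) <;> simp
  map_comp f g := by ext (x | x) <;> simp

namespace double

variable {X Y : SSet.{u}}

/-- The first inclusion of a simplicial set into its double. -/
def inl : X ⟶ double X where
  app n := ↾Sum.inl

/-- The second inclusion of a simplicial set into its double. -/
def inr : X ⟶ double X where
  app n := ↾Sum.inr

/-- Maps out of the double. -/
def desc (f g : X ⟶ Y) : double X ⟶ Y where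
  app n := ↾(Sum.elim (f.app n) (g.app n))
  naturality n m φ := by
    ext (x | x)
    · exact NatTrans.naturality_apply f φ x
    · exact NatTrans.naturality_apply g φ x

@[simp]
lemma inl_desc (f g : X ⟶ Y) : inl ≫ desc f g = f := rfl

@[simp]
lemma inl_desc_assoc {Z : SSet.{u}} (f g : X ⟶ Y) (h : Y ⟶ Z) :
    inl ≫ desc f g ≫ h = f ≫ h := rfl

@[simp]
lemma inr_desc (f g : X ⟶ Y) : inr ≫ desc f g = g := rfl

@[simp]
lemma inr_desc_assoc {Z : SSet.{u}} (f g : X ⟶ Y) (h : Y ⟶ Z) :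
    inr ≫ desc f g ≫ h = g ≫ h := rfl

lemma hom_ext {f g : double X ⟶ Y} (h₁ : inl ≫ f = inl ≫ g) (h₂ : inr ≫ f = inr ≫ g) : f = g := by
  ext n (x | x)
  · exact congrArg (fun φ ↦ φ.app n x) h₁
  · exact congrArg (fun φ ↦ φ.app n x) h₂

instance mono_desc_ι : Mono (desc (ι₀ (X := X)) ι₁) := by
  have : ∀ n, Mono ((desc (ι₀ (X := X)) ι₁).app n) := by
    intro ⟨n⟩
    induction n using SimplexCategory.rec with | _ n
    rw [mono_iff_injective]
    rintro (x | x) (y | y) h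
    · exact congrArg Sum.inl (congrArg Prod.fst h)
    · have := congrArg (fun z : (X ⊗ Δ[1]) _⦋n⦌ ↦ stdSimplex.objEquiv z.2 0) h
      exact absurd this (by change ¬ ((0 : Fin 2) = 1); decide)
    · have := congrArg (fun z : (X ⊗ Δ[1]) _⦋n⦌ ↦ stdSimplex.objEquiv z.2 0) h
      exact absurd this (by change ¬ ((1 : Fin 2) = 0); decide)
    · exact congrArg Sum.inr (congrArg Prod.fst h)
  exact NatTrans.mono_of_mono_app _

end double

/-- A map with the right lifting property with respect to boundary inclusions is an equivalence. -/
lemma isSpaceEquiv_of_rlp_boundary {X Y : SSet.{u}} {p : X ⟶ Y} (hp : I.rlp p) :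
    IsSpaceEquiv p := by
  obtain ⟨s, -, hs⟩ := exists_lift_of_rlp_boundary hp (⊥ : Y.Subcomplex).ι
    (Subcomplex.isInitialBot.to _) (𝟙 Y) (Subcomplex.isInitialBot.hom_ext _ _)
  -- A lift that extends `p ≫ s` and the identity from the two ends of the cylinder is a homotopy
  -- between them.
  obtain ⟨L, h₁, h₂⟩ := exists_lift_of_rlp_boundary hp (double.desc (ι₀ (X := X)) ι₁)
    (double.desc (p ≫ s) (𝟙 X)) (fst _ _ ≫ p) (double.hom_ext (by simp [hs]) (by simp))
  have h₁l := double.inl ≫= h₁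
  have h₁r := double.inr ≫= h₁
  simp only [double.inl_desc, double.inl_desc_assoc, double.inr_desc, double.inr_desc_assoc]
    at h₁l h₁r
  refine ⟨⟨s, ?_⟩, ⟨s, MapsHomotopic.mk L h₁l h₁r⟩⟩
  rw [hs]
  exact MapsHomotopic.refl _

/-! ### Fibres over points joined by a path -/

/-- The fibre of `s` over `a`, defined by an equation. -/
def constFibre {E P : SSet.{u}} (s : E ⟶ P) (a : P _⦋0⦌) : E.Subcomplex where
  obj l := {σ | s.app l σ = (const a : E ⟶ P).app l σ}
  map {l k} g σ hσ := by
    refine (NatTrans.naturality_apply s g σ).trans ?_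
    exact (congrArg (P.map g) hσ).trans (NatTrans.naturality_apply (const a : E ⟶ P) g σ).symm

lemma exists_lift_constFibre {T E P : SSet.{u}} (s : E ⟶ P) (a : P _⦋0⦌) (u : T ⟶ E)
    (h : u ≫ s = const a) :
    ∃ v : T ⟶ constFibre s a, v ≫ (constFibre s a).ι = u := by
  refine ⟨Subcomplex.lift u ?_, rfl⟩
  rintro n _ ⟨x, rfl⟩
  exact congrArg (fun φ ↦ φ.app n x) h

lemma constFibre_ι_comp {E P : SSet.{u}} (s : E ⟶ P) (a : P _⦋0⦌) :
    (constFibre s a).ι ≫ s = const a := by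
  ext n x
  exact x.2

/-- Let `(s, t) : E ⟶ P × Q` be a Kan fibration. If `t` is a trivial fibration on the fibre of `s`
over a point, then so it is over any point joined to it by a path. -/
lemma rlp_boundary_constFibre_of_path {E P Q : SSet.{u}} (s : E ⟶ P) (t : E ⟶ Q)
    [Fibration (lift s t)] (γ : Δ[1] ⟶ P) (e e' : Fin 2)
    (h : I.rlp ((constFibre s (γ.app _ (stdSimplex.obj₀Equiv.symm e))).ι ≫ t)) :
    I.rlp ((constFibre s (γ.app _ (stdSimplex.obj₀Equiv.symm e'))).ι ≫ t) := by
  refine rlp_boundary_of_exists _ fun n a b w ↦ ?_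
  have hend (B : SSet.{u}) (e : Fin 2) : cylinderEnd B e ≫ snd _ _ ≫ γ =
    const (γ.app _ (stdSimplex.obj₀Equiv.symm e)) := by
    rw [cylinderEnd_snd_assoc]; simp
  -- The boundary `a` is transported along `γ` from the fibre at `e'` to the fibre at `e`, keeping
  -- its image under `t` fixed.
  obtain ⟨G, hG₁, hG₂⟩ := exists_homotopy_lift_absolute (lift s t) e' (a ≫ Subcomplex.ι _)
    (lift (snd _ _ ≫ γ) (fst _ _ ≫ ∂Δ[n].ι ≫ b)) (by
      refine CartesianMonoidalCategory.hom_ext _ _ ?_ ?_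
      · simp only [Category.assoc, lift_fst, hend, constFibre_ι_comp]
        simp
      · simpa using w)
  have hG₂s : G ≫ s = snd _ _ ≫ γ := by simpa using hG₂ =≫ fst _ _
  have hG₂t : G ≫ t = fst _ _ ≫ ∂Δ[n].ι ≫ b := by simpa using hG₂ =≫ snd _ _
  obtain ⟨v, hv⟩ := exists_lift_constFibre s _ (cylinderEnd _ e ≫ G)
    (by rw [Category.assoc, hG₂s, hend])
  obtain ⟨c, hc₁, hc₂⟩ := exists_lift_of_rlp_boundary h ∂Δ[n].ι v b (by
    rw [reassoc_of% hv, hG₂t, cylinderEnd_fst_assoc])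
  -- The solution `c` at `e` is transported back to `e'`, using the transport `G` already chosen on
  -- the boundary.
  obtain ⟨k, hk₁, hk₂, hk₃⟩ := exists_homotopy_lift (lift s t) ∂Δ[n] e G (c ≫ Subcomplex.ι _)
    (lift (snd _ _ ≫ γ) (fst _ _ ≫ b)) (by rw [reassoc_of% hc₁, hv])
    (by
      rw [hG₂]
      refine CartesianMonoidalCategory.hom_ext _ _ ?_ ?_ <;> simp)
    (by
      refine CartesianMonoidalCategory.hom_ext _ _ ?_ ?_
      · simp only [Category.assoc, lift_fst, hend, constFibre_ι_comp]
        simp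
      · simpa using hc₂)
  have hk₃s : k ≫ s = snd _ _ ≫ γ := by simpa using hk₃ =≫ fst _ _
  have hk₃t : k ≫ t = fst _ _ ≫ b := by simpa using hk₃ =≫ snd _ _
  obtain ⟨l, hl⟩ := exists_lift_constFibre s _ (cylinderEnd _ e' ≫ k)
    (by rw [Category.assoc, hk₃s, hend])
  refine ⟨l, ?_, ?_⟩
  · rw [← cancel_mono (Subcomplex.ι _), Category.assoc, hl, cylinderEnd_naturality_assoc, hk₁, hG₁]
  · rw [reassoc_of% hl, hk₃t, cylinderEnd_fst_assoc]

end SSet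

/-! ### Mapping spaces out of levelwise discrete simplicial spaces -/

namespace SimplicialSpace

open SSet CartesianMonoidalCategory Limits modelCategoryQuillen

/-- The simplicial set `n ↦ Hom(K, W_n)`. -/
def homFrom (K : SSet.{u}) (W : SimplicialSpace.{u}) : SSet.{u} where
  obj n := K ⟶ W.obj n
  map f := ↾fun φ ↦ φ ≫ W.map f

/-- Precomposition. -/
def homFrom.precomp {K L : SSet.{u}} (i : K ⟶ L) (W : SimplicialSpace.{u}) :
    homFrom L W ⟶ homFrom K W where
  app n := ↾fun φ ↦ i ≫ φ

variable {A B K L : SSet.{u}} {W : SimplicialSpace.{u}}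

/-- The restriction of a simplex along a simplex of a standard simplex. -/
def restrictSimplex (K : SSet.{u}) {l m : SimplexCategoryᵒᵖ} (κ : K.obj l)
    (θ : (SSet.stdSimplex.{u}.obj l.unop).obj m) : K.obj m :=
  K.map (SSet.stdSimplex.objEquiv θ).op κ

/-- The transpose `K ⟶ Map(A, W)` of a map `A ⟶ Hom(K, W)`. -/
def toMap (φ : A ⟶ homFrom K W) : K ⟶ Map (discreteEmb.obj A) W where
  app l := ↾fun κ ↦
    { app k :=
        { app m := ↾fun (x : A.obj k × (SSet.stdSimplex.{u}.obj l.unop).obj m) ↦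
            ((φ.app k x.1 : K ⟶ W.obj k)).app m (restrictSimplex K κ x.2)
          naturality m m' g := by
            ext ⟨a, θ⟩
            refine Eq.trans ?_ (NatTrans.naturality_apply (φ.app k a : K ⟶ W.obj k) g _)
            refine congrArg ((φ.app k a : K ⟶ W.obj k).app m') ?_
            exact ConcreteCategory.congr_hom (K.map_comp (SSet.stdSimplex.objEquiv θ).op g) κ }
      naturality k k' f := by
        ext m ⟨a, θ⟩
        have := NatTrans.naturality_apply φ f a
        exact congrArg (fun (ψ : K ⟶ W.obj k') ↦ ψ.app m (restrictSimplex K κ θ)) this }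
  naturality l l' g := by
    refine ConcreteCategory.hom_ext _ _ fun κ ↦ ?_
    refine NatTrans.ext (funext fun k ↦ NatTrans.ext (funext fun m ↦ ?_))
    refine ConcreteCategory.hom_ext _ _ fun (x : A.obj k × (SSet.stdSimplex.{u}.obj l'.unop).obj m) ↦ ?_
    refine congrArg ((φ.app k x.1 : K ⟶ W.obj k).app m) ?_
    exact (ConcreteCategory.congr_hom (K.map_comp g (SSet.stdSimplex.objEquiv x.2).op) κ).symm

/-- The simplex `(a, id)` of `A × Δ[l]` given by a simplex `a` of `A`. -/
def genericSimplex (A : SSet.{u}) {k : SimplexCategoryᵒᵖ} (a : A.obj k) (l : SimplexCategoryᵒᵖ) :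
    ((discreteEmb.obj A ⊗ constantEmb.obj (SSet.stdSimplex.obj l.unop)).obj k).obj l :=
  let j : (SSet.stdSimplex.{u}.obj l.unop).obj l := SSet.stdSimplex.objEquiv.symm (𝟙 l.unop)
  (a, j)

/-- The transpose `A ⟶ Hom(K, W)` of a map `K ⟶ Map(A, W)`. -/
def ofMap (ψ : K ⟶ Map (discreteEmb.obj A) W) : A ⟶ homFrom K W where
  app k := ↾fun a ↦
    { app l := ↾fun κ ↦
        ((ψ.app l κ : discreteEmb.obj A ⊗ constantEmb.obj (SSet.stdSimplex.obj l.unop) ⟶ W).app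
          k).app l (genericSimplex A a l)
      naturality l l' g := by
        ext κ
        have h := NatTrans.naturality_apply ψ g κ
        refine (congrArg (fun χ : discreteEmb.obj A ⊗ constantEmb.obj
          (SSet.stdSimplex.obj l'.unop) ⟶ W ↦ (χ.app k).app l'
            (genericSimplex A a l')) h).trans ?_
        refine Eq.trans ?_ (NatTrans.naturality_apply (F := (discreteEmb.obj A ⊗
          constantEmb.obj (SSet.stdSimplex.obj l.unop)).obj k)
          ((ψ.app l κ : discreteEmb.obj A ⊗ constantEmb.obj (SSet.stdSimplex.obj l.unop) ⟶ W).app k)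
            g (genericSimplex A a l))
        refine congrArg (((ψ.app l κ : discreteEmb.obj A ⊗ constantEmb.obj
          (SSet.stdSimplex.obj l.unop) ⟶ W).app k).app l') (Prod.ext rfl ?_)
        exact congrArg SSet.stdSimplex.objEquiv.symm
          ((Category.id_comp g.unop).trans (Category.comp_id g.unop).symm) }
  naturality k k' f := by
    refine ConcreteCategory.hom_ext _ _ fun a ↦ NatTrans.ext (funext fun l ↦ ?_)
    refine ConcreteCategory.hom_ext _ _ fun κ ↦ ?_
    exact congrArg (fun χ ↦ χ.app l (genericSimplex A a l))
      ((ψ.app l κ : discreteEmb.obj A ⊗ constantEmb.obj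
        (SSet.stdSimplex.obj l.unop) ⟶ W).naturality f)

lemma ofMap_toMap (φ : A ⟶ homFrom K W) : ofMap (toMap φ) = φ := by
  refine NatTrans.ext (funext fun k ↦ ConcreteCategory.hom_ext _ _ fun a ↦
    NatTrans.ext (funext fun l ↦ ConcreteCategory.hom_ext _ _ fun κ ↦ ?_))
  refine congrArg ((φ.app k a : K ⟶ W.obj k).app l) ?_
  exact ConcreteCategory.congr_hom (K.map_id l) κ

lemma toMap_ofMap (ψ : K ⟶ Map (discreteEmb.obj A) W) : toMap (ofMap ψ) = ψ := by
  refine NatTrans.ext (funext fun l ↦ ConcreteCategory.hom_ext _ _ fun κ ↦ ?_)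
  refine NatTrans.ext (funext fun k ↦ NatTrans.ext (funext fun m ↦ ?_))
  refine ConcreteCategory.hom_ext _ _ fun (x : A.obj k × (SSet.stdSimplex.{u}.obj l.unop).obj m) ↦ ?_
  have h := NatTrans.naturality_apply ψ (SSet.stdSimplex.objEquiv x.2).op κ
  refine (congrArg (fun χ : discreteEmb.obj A ⊗ constantEmb.obj
    (SSet.stdSimplex.obj m.unop) ⟶ W ↦ (χ.app k).app m
      (genericSimplex A x.1 m)) h).trans ?_
  refine congrArg (((ψ.app l κ : discreteEmb.obj A ⊗ constantEmb.obj
    (SSet.stdSimplex.obj l.unop) ⟶ W).app k).app m) (Prod.ext rfl ?_)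
  exact SSet.stdSimplex.objEquiv.injective (Category.id_comp (SSet.stdSimplex.objEquiv x.2))

lemma toMap_naturality_left (j : A ⟶ B) (φ : B ⟶ homFrom K W) :
    toMap (j ≫ φ) = toMap φ ≫ Map.precomp (discreteEmb.map j) W := rfl

lemma toMap_naturality_right (i : K ⟶ L) (φ : A ⟶ homFrom L W) :
    toMap (φ ≫ homFrom.precomp i W) = i ≫ toMap φ := by
  refine NatTrans.ext (funext fun l ↦ ConcreteCategory.hom_ext _ _ fun κ ↦ ?_)
  refine NatTrans.ext (funext fun k ↦ NatTrans.ext (funext fun m ↦ ?_))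
  refine ConcreteCategory.hom_ext _ _ fun (x : A.obj k × (SSet.stdSimplex.{u}.obj l.unop).obj m) ↦ ?_
  exact congrArg ((φ.app k x.1 : L ⟶ W.obj k).app m)
    (NatTrans.naturality_apply i (SSet.stdSimplex.objEquiv x.2).op κ)

lemma ofMap_naturality_left (j : A ⟶ B) (ψ : K ⟶ Map (discreteEmb.obj B) W) :
    ofMap (ψ ≫ Map.precomp (discreteEmb.map j) W) = j ≫ ofMap ψ := rfl

lemma ofMap_naturality_right (i : K ⟶ L) (ψ : L ⟶ Map (discreteEmb.obj A) W) :
    ofMap (i ≫ ψ) = ofMap ψ ≫ homFrom.precomp i W := rfl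

/-- The transposition between maps K ⟶ Map(A, W) and maps A ⟶ Hom(K, W) is natural in both
variables, so lifting squares and their solutions correspond. -/
lemma hasLiftingProperty_precomp_iff (j : A ⟶ B) (i : K ⟶ L) (W : SimplicialSpace.{u}) :
    HasLiftingProperty i (Map.precomp (discreteEmb.map j) W) ↔
      HasLiftingProperty j (homFrom.precomp i W) := by
  constructor
  · intro _
    refine ⟨fun {f g} sq ↦ ?_⟩
    have sq' : CommSq (toMap g) i (Map.precomp (discreteEmb.map j) W) (toMap f) :=
      ⟨by rw [← toMap_naturality_left, ← sq.w, toMap_naturality_right]⟩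
    refine ⟨⟨⟨ofMap sq'.lift, ?_, ?_⟩⟩⟩
    · rw [← ofMap_naturality_left, sq'.fac_right, ofMap_toMap]
    · rw [← ofMap_naturality_right, sq'.fac_left, ofMap_toMap]
  · intro _
    refine ⟨fun {f g} sq ↦ ?_⟩
    have sq' : CommSq (ofMap g) j (homFrom.precomp i W) (ofMap f) :=
      ⟨by rw [← ofMap_naturality_right, ← sq.w, ofMap_naturality_left]⟩
    refine ⟨⟨⟨toMap sq'.lift, ?_, ?_⟩⟩⟩
    · rw [← toMap_naturality_right, sq'.fac_right, toMap_ofMap]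
    · rw [← toMap_naturality_left, sq'.fac_left, toMap_ofMap]

namespace IsReedyFibrant

/-- This is Reedy fibrancy transposed: restriction along a horn inclusion is a trivial fibration
Hom(L, W) ⟶ Hom(K, W). In this form boundary inclusions can be replaced by arbitrary monomorphisms.
-/
lemma rlp_boundary_homFrom (hW : W.IsReedyFibrant) {i : K ⟶ L} (hi : J i) :
    I.rlp (homFrom.precomp i W) := by
  rintro _ _ _ ⟨n⟩
  rw [← hasLiftingProperty_precomp_iff]
  exact ((SSet.modelCategoryQuillen.fibration_iff _).1 (hW n)) i hi

lemma fibration_precomp (hW : W.IsReedyFibrant) (j : A ⟶ B) [Mono j] :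
    Fibration (Map.precomp (discreteEmb.map j) W) := by
  rw [SSet.modelCategoryQuillen.fibration_iff]
  intro _ _ i hi
  rw [hasLiftingProperty_precomp_iff]
  have := hW.rlp_boundary_homFrom hi
  rw [← rlp_monomorphisms] at this
  exact this j (MorphismProperty.monomorphisms.infer_property j)

end IsReedyFibrant

lemma _root_.SSet.kanComplex_of_exists_extension (X : SSet.{u})
    (h : ∀ ⦃K L : SSet.{u}⦄ (i : K ⟶ L), J i → ∀ f : K ⟶ X, ∃ g : L ⟶ X, i ≫ g = f) :
    KanComplex X := by
  rw [KanComplex, isFibrant_iff, SSet.modelCategoryQuillen.fibration_iff]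
  intro _ _ i hi
  refine ⟨fun {f g} sq ↦ ?_⟩
  obtain ⟨l, hl⟩ := h i hi f
  exact ⟨⟨⟨l, hl, by subsingleton⟩⟩⟩

lemma IsReedyFibrant.kanComplex_map (hW : W.IsReedyFibrant) (A : SSet.{u}) :
    KanComplex (Map (discreteEmb.obj A) W) := by
  refine kanComplex_of_exists_extension _ fun K L i hi f ↦ ?_
  obtain ⟨l, -, hl⟩ := exists_lift_of_rlp_boundary (hW.rlp_boundary_homFrom hi)
    (⊥ : A.Subcomplex).ι (Subcomplex.isInitialBot.to _) (ofMap f)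
    (Subcomplex.isInitialBot.hom_ext _ _)
  exact ⟨toMap l, by rw [← toMap_naturality_right, hl, toMap_ofMap]⟩

lemma IsReedyFibrant.kanComplex_obj (hW : W.IsReedyFibrant) (n : ℕ) :
    KanComplex (W _⦋n⦌) := by
  refine kanComplex_of_exists_extension _ fun K L i hi f ↦ ?_
  obtain ⟨l, -, hl⟩ := exists_lift_of_rlp_boundary (hW.rlp_boundary_homFrom hi)
    (⊥ : (Δ[n] : SSet.{u}).Subcomplex).ι (Subcomplex.isInitialBot.to _)
    (yonedaEquiv.symm (show (homFrom K W) _⦋n⦌ from f))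
    (Subcomplex.isInitialBot.hom_ext _ _)
  refine ⟨yonedaEquiv l, ?_⟩
  have := congrArg yonedaEquiv hl
  rw [Equiv.apply_symm_apply] at this
  exact this

end SimplicialSpace

/-! ### The arrow object W^F(1) and its source and target -/

namespace SimplicialSpace

open SSet CartesianMonoidalCategory Limits modelCategoryQuillen

/-- The discrete embedding preserves products. -/
def discreteEmbProd (A B : SSet.{u}) :
    discreteEmb.obj (A ⊗ B) ≅ discreteEmb.obj A ⊗ discreteEmb.obj B where
  hom := { app k := { app m := ↾fun (x : A.obj k × B.obj k) ↦ x } }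
  inv := { app k := { app m := ↾fun (x : A.obj k × B.obj k) ↦ x } }

lemma Map.precomp_comp {A B C : SimplicialSpace.{u}} (f : A ⟶ B) (g : B ⟶ C)
    (X : SimplicialSpace.{u}) :
    Map.precomp (f ≫ g) X = Map.precomp g X ≫ Map.precomp f X := by
  refine NatTrans.ext (funext fun l ↦ ConcreteCategory.hom_ext _ _ fun φ ↦ ?_)
  exact (congrArg (· ≫ φ) (comp_whiskerRight f g _)).trans (Category.assoc _ _ _)

lemma Map.precomp_id (A X : SimplicialSpace.{u}) : Map.precomp (𝟙 A) X = 𝟙 _ := by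
  refine NatTrans.ext (funext fun l ↦ ConcreteCategory.hom_ext _ _ fun φ ↦ ?_)
  exact (congrArg (· ≫ φ) (id_whiskerRight A _)).trans (Category.id_comp _)

variable {K L : SSet.{u}} {W : SimplicialSpace.{u}} {n : ℕ}

/-- The map to a space of arrows given by a map `Δ[n] × Δ[1] ⟶ Hom(L, W)`. -/
def toExp (φ : Δ[n] ⊗ Δ[1] ⟶ homFrom L W) : L ⟶ W.exp (F.obj ⦋1⦌) _⦋n⦌ :=
  toMap φ ≫ Map.precomp (discreteEmbProd _ _).inv W

/-- The map `Δ[n] × Δ[1] ⟶ Hom(L, W)` given by a map to a space of arrows. -/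
def ofExp (ψ : L ⟶ W.exp (F.obj ⦋1⦌) _⦋n⦌) : Δ[n] ⊗ Δ[1] ⟶ homFrom L W :=
  ofMap (A := Δ[n] ⊗ Δ[1])
    ((show L ⟶ Map (F.obj ⦋n⦌ ⊗ F.obj ⦋1⦌) W from ψ) ≫ Map.precomp (discreteEmbProd _ _).hom W)

lemma toExp_ofExp (ψ : L ⟶ W.exp (F.obj ⦋1⦌) _⦋n⦌) : toExp (ofExp ψ) = ψ := by
  have h : Map.precomp (discreteEmbProd Δ[n] Δ[1]).hom W ≫
      Map.precomp (discreteEmbProd _ _).inv W = 𝟙 _ := by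
    rw [← Map.precomp_comp, Iso.inv_hom_id, Map.precomp_id]
  rw [toExp, ofExp, toMap_ofMap]
  exact (Category.assoc _ _ _).trans ((congrArg (ψ ≫ ·) h).trans (Category.comp_id _))

lemma ofExp_toExp (φ : Δ[n] ⊗ Δ[1] ⟶ homFrom L W) : ofExp (toExp φ) = φ := by
  have h : Map.precomp (discreteEmbProd Δ[n] Δ[1]).inv W ≫
      Map.precomp (discreteEmbProd _ _).hom W = 𝟙 _ := by
    rw [← Map.precomp_comp, Iso.hom_inv_id, Map.precomp_id]
  rw [ofExp, toExp]
  refine Eq.trans ?_ (ofMap_toMap φ)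
  refine congrArg ofMap ?_
  exact (Category.assoc _ _ _).trans ((congrArg (toMap φ ≫ ·) h).trans (Category.comp_id _))

lemma toExp_naturality (i : K ⟶ L) (φ : Δ[n] ⊗ Δ[1] ⟶ homFrom L W) :
    toExp (φ ≫ homFrom.precomp i W) = i ≫ toExp φ := by
  rw [toExp, toMap_naturality_right]
  exact Category.assoc _ _ _

lemma toExp_expSrc (φ : Δ[n] ⊗ Δ[1] ⟶ homFrom L W) :
    toExp φ ≫ W.expSrc.app (op ⦋n⦌) = yonedaEquiv (ι₀ ≫ φ) := by
  refine NatTrans.ext (funext fun l ↦ ConcreteCategory.hom_ext _ _ fun κ ↦ ?_)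
  refine congrArg ((yonedaEquiv (ι₀ ≫ φ) : L ⟶ W _⦋n⦌).app l) ?_
  exact ConcreteCategory.congr_hom (L.map_id l) κ

lemma toExp_expTgt (φ : Δ[n] ⊗ Δ[1] ⟶ homFrom L W) :
    toExp φ ≫ W.expTgt.app (op ⦋n⦌) = yonedaEquiv (ι₁ ≫ φ) := by
  refine NatTrans.ext (funext fun l ↦ ConcreteCategory.hom_ext _ _ fun κ ↦ ?_)
  refine congrArg ((yonedaEquiv (ι₁ ≫ φ) : L ⟶ W _⦋n⦌).app l) ?_
  exact ConcreteCategory.congr_hom (L.map_id l) κ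

lemma expSrc_eq (ψ : L ⟶ W.exp (F.obj ⦋1⦌) _⦋n⦌) :
    ψ ≫ W.expSrc.app (op ⦋n⦌) = yonedaEquiv (ι₀ ≫ ofExp ψ) := by
  rw [← toExp_expSrc, toExp_ofExp]

lemma expTgt_eq (ψ : L ⟶ W.exp (F.obj ⦋1⦌) _⦋n⦌) :
    ψ ≫ W.expTgt.app (op ⦋n⦌) = yonedaEquiv (ι₁ ≫ ofExp ψ) := by
  rw [← toExp_expTgt, toExp_ofExp]

/-- A map `L ⟶ W_n` as a map `Δ[n] ⟶ Hom(L, W)`. -/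
def ofObj (f : L ⟶ W _⦋n⦌) : Δ[n] ⟶ homFrom L W :=
  yonedaEquiv.symm (show (homFrom L W) _⦋n⦌ from f)

lemma yonedaEquiv_ofObj (f : L ⟶ W _⦋n⦌) : yonedaEquiv (ofObj f) = f :=
  yonedaEquiv.apply_symm_apply _

lemma ofObj_yonedaEquiv (φ : Δ[n] ⟶ homFrom L W) : ofObj (yonedaEquiv φ) = φ :=
  yonedaEquiv.symm_apply_apply _

lemma yonedaEquiv_comp_precomp (i : K ⟶ L) (φ : Δ[n] ⟶ homFrom L W) :
    (yonedaEquiv (φ ≫ homFrom.precomp i W) : K ⟶ W _⦋n⦌) = i ≫ (yonedaEquiv φ : L ⟶ W _⦋n⦌) :=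
  rfl

lemma ofObj_naturality (i : K ⟶ L) (f : L ⟶ W _⦋n⦌) :
    ofObj (i ≫ f) = ofObj f ≫ homFrom.precomp i W := by
  apply yonedaEquiv.injective
  rw [yonedaEquiv_ofObj]
  refine Eq.trans ?_ (yonedaEquiv_comp_precomp i (ofObj f)).symm
  rw [yonedaEquiv_ofObj]

/-- The map `(source, target) : W ^ F(1) ⟶ W × W` is a levelwise Kan fibration. -/
lemma IsReedyFibrant.fibration_expSrc_expTgt (hW : W.IsReedyFibrant) (n : ℕ) :
    Fibration (lift (W.expSrc.app (op ⦋n⦌)) (W.expTgt.app (op ⦋n⦌))) := by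
  rw [SSet.modelCategoryQuillen.fibration_iff]
  intro K L i hi
  refine ⟨fun {f g} sq ↦ ?_⟩
  have hs : f ≫ W.expSrc.app (op ⦋n⦌) = i ≫ g ≫ fst _ _ := by simpa using sq.w =≫ fst _ _
  have ht : f ≫ W.expTgt.app (op ⦋n⦌) = i ≫ g ≫ snd _ _ := by simpa using sq.w =≫ snd _ _
  -- After transposition, the problem is to extend along the monomorphism Δ[n] × ∂Δ[1] ⟶ Δ[n] ×
  -- Δ[1], against the trivial fibration given by `i`.
  obtain ⟨l, hl₁, hl₂⟩ := exists_lift_of_rlp_boundary (hW.rlp_boundary_homFrom hi)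
    (double.desc (ι₀ (X := Δ[n])) ι₁)
    (double.desc (ofObj (g ≫ fst _ _)) (ofObj (g ≫ snd _ _))) (ofExp f)
    (double.hom_ext
      (by
        rw [double.inl_desc_assoc, double.inl_desc_assoc, ← ofObj_naturality, ← hs, expSrc_eq,
          ofObj_yonedaEquiv])
      (by
        rw [double.inr_desc_assoc, double.inr_desc_assoc, ← ofObj_naturality, ← ht, expTgt_eq,
          ofObj_yonedaEquiv]))
  have hl₀ := double.inl ≫= hl₁
  have hl₁ := double.inr ≫= hl₁
  simp only [double.inl_desc, double.inl_desc_assoc, double.inr_desc, double.inr_desc_assoc]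
    at hl₀ hl₁
  refine ⟨⟨⟨toExp l, ?_, ?_⟩⟩⟩
  · rw [← toExp_naturality, hl₂, toExp_ofExp]
  · refine CartesianMonoidalCategory.hom_ext _ _ ?_ ?_
    · rw [Category.assoc, lift_fst, toExp_expSrc, hl₀, yonedaEquiv_ofObj]
    · rw [Category.assoc, lift_snd, toExp_expTgt, hl₁, yonedaEquiv_ofObj]

/-- The map `W_1 ⟶ (W ^ F(1))_0`. -/
def arrowToExp (W : SimplicialSpace.{u}) : W _⦋1⦌ ⟶ W.exp (F.obj ⦋1⦌) _⦋0⦌ :=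
  toExp (snd _ _ ≫ ofObj (𝟙 _))

/-- The map `(W ^ F(1))_0 ⟶ W_1`. -/
def expToArrow (W : SimplicialSpace.{u}) : W.exp (F.obj ⦋1⦌) _⦋0⦌ ⟶ W _⦋1⦌ :=
  yonedaEquiv (lift (toPoint _) (𝟙 _) ≫ ofExp (𝟙 _))

lemma comp_expToArrow (ψ : L ⟶ W.exp (F.obj ⦋1⦌) _⦋0⦌) :
    ψ ≫ W.expToArrow = yonedaEquiv (lift (toPoint _) (𝟙 _) ≫ ofExp ψ) := rfl

/-- W_1 is a retract of (W^F(1))_0, compatibly with source and target. This suffices to move lifting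
problems for arrows into W^F(1) and their solutions back. -/
lemma arrowToExp_expToArrow (W : SimplicialSpace.{u}) : W.arrowToExp ≫ W.expToArrow = 𝟙 _ := by
  rw [comp_expToArrow, arrowToExp, ofExp_toExp, lift_snd_assoc, Category.id_comp, yonedaEquiv_ofObj]

lemma yonedaEquiv_δ_comp {n : ℕ} (i : Fin (n + 2)) (φ : Δ[n + 1] ⟶ homFrom L W) :
    (yonedaEquiv (stdSimplex.δ i ≫ φ) : L ⟶ W _⦋n⦌) = (yonedaEquiv φ : L ⟶ W _⦋n + 1⦌) ≫ W.δ i := by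
  obtain ⟨x, rfl⟩ := yonedaEquiv.symm.surjective φ
  rw [Equiv.apply_symm_apply]
  exact (stdSimplex.yonedaEquiv_δ_comp _ _).trans (congrArg _ (yonedaEquiv.apply_symm_apply x))

lemma expToArrow_src (W : SimplicialSpace.{u}) :
    W.expToArrow ≫ W.src = W.expSrc.app (op ⦋0⦌) := by
  rw [expToArrow]
  refine (yonedaEquiv_δ_comp _ _).symm.trans ?_
  rw [← Category.id_comp (W.expSrc.app (op ⦋0⦌)), expSrc_eq, ← Category.assoc]
  congr 2
  refine CartesianMonoidalCategory.hom_ext _ _ (by ext) ?_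
  simp only [Category.assoc, lift_snd, Category.comp_id]
  exact stdSimplex.δ_one_eq_const

lemma expToArrow_tgt (W : SimplicialSpace.{u}) :
    W.expToArrow ≫ W.tgt = W.expTgt.app (op ⦋0⦌) := by
  rw [expToArrow]
  refine (yonedaEquiv_δ_comp _ _).symm.trans ?_
  rw [← Category.id_comp (W.expTgt.app (op ⦋0⦌)), expTgt_eq, ← Category.assoc]
  congr 2
  refine CartesianMonoidalCategory.hom_ext _ _ (by ext) ?_
  simp only [Category.assoc, lift_snd, Category.comp_id]
  exact stdSimplex.δ_zero_eq_const

lemma arrowToExp_expSrc (W : SimplicialSpace.{u}) :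
    W.arrowToExp ≫ W.expSrc.app (op ⦋0⦌) = W.src := by
  rw [← expToArrow_src, reassoc_of% W.arrowToExp_expToArrow]

lemma arrowToExp_expTgt (W : SimplicialSpace.{u}) :
    W.arrowToExp ≫ W.expTgt.app (op ⦋0⦌) = W.tgt := by
  rw [← expToArrow_tgt, reassoc_of% W.arrowToExp_expToArrow]

end SimplicialSpace

/-! ### Contractibility criteria and path-closed subspaces -/

namespace SSet

open CartesianMonoidalCategory Limits modelCategoryQuillen

/-- On the fibre of `s` over `a`, a lifting problem against `t` is one against `lift s t` with
constant first component `a`. -/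
lemma fibration_constFibre {E P Q : SSet.{u}} (s : E ⟶ P) (t : E ⟶ Q) [Fibration (lift s t)]
    (a : P _⦋0⦌) : Fibration ((constFibre s a).ι ≫ t) := by
  rw [SSet.modelCategoryQuillen.fibration_iff]
  intro K L i hi
  refine ⟨fun {f g} sq ↦ ?_⟩
  have : HasLiftingProperty i (lift s t) :=
    (SSet.modelCategoryQuillen.fibration_iff _).1 inferInstance i hi
  have sq' : CommSq (f ≫ Subcomplex.ι _) i (lift s t) (lift (const a) g) := by
    refine ⟨CartesianMonoidalCategory.hom_ext _ _ ?_ ?_⟩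
    · simp only [Category.assoc, lift_fst, constFibre_ι_comp]
      simp
    · simpa using sq.w
  have hs : sq'.lift ≫ s = const a := by simpa using sq'.fac_right =≫ fst _ _
  have ht : sq'.lift ≫ t = g := by simpa using sq'.fac_right =≫ snd _ _
  obtain ⟨v, hv⟩ := exists_lift_constFibre s a _ hs
  refine ⟨⟨⟨v, ?_, by rw [reassoc_of% hv, ht]⟩⟩⟩
  rw [← cancel_mono (Subcomplex.ι _), Category.assoc, hv, sq'.fac_left]

lemma isContractibleSpace_of_homotopy {K : SSet.{u}} (hK : KanComplex K) (x : K _⦋0⦌)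
    (h : MapsHomotopic (const x) (𝟙 K)) : IsContractibleSpace K := by
  refine ⟨hK, ⟨const x, ?_⟩, ⟨const x, ?_⟩⟩
  · rw [stdSimplex.isTerminalObj₀.hom_ext (const x ≫ K.toPoint) (𝟙 _)]
    exact MapsHomotopic.refl _
  · rw [comp_const]
    exact h

lemma isFibration_toPoint (K : SSet.{u}) [h : KanComplex K] : IsKanFibration K.toPoint :=
  (isFibrant_iff_of_isTerminal K.toPoint stdSimplex.isTerminalObj₀).1 h

lemma fibre_toPoint (K : SSet.{u}) (y : (Δ[0] : SSet.{u}) _⦋0⦌) : fibre K.toPoint y = ⊤ := by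
  ext n x
  refine iff_of_true ?_ trivial
  refine (Subcomplex.mem_ofSimplex_obj_iff _ _).2 ⟨SimplexCategory.const _ _ 0, ?_⟩
  exact congrArg (fun φ : K ⟶ Δ[0] ↦ φ.app n x)
    (stdSimplex.isTerminalObj₀.hom_ext (const y) K.toPoint)

/-- The only fibre over the point is `K` itself. If `K` has no vertices it has no simplices;
otherwise any vertex gives a contraction. -/
lemma isNegOneTruncated_of_homotopy (K : SSet.{u}) [KanComplex K]
    (h : ∀ x : K _⦋0⦌, MapsHomotopic (const x) (𝟙 K)) : IsNegOneTruncated K := by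
  refine ⟨isFibration_toPoint K, fun y ↦ ?_⟩
  rw [fibre_toPoint]
  by_cases hK : Nonempty (K _⦋0⦌)
  · obtain ⟨x⟩ := hK
    left
    have : KanComplex ((⊤ : K.Subcomplex) : SSet.{u}) :=
      isFibrant_of_fibration (Subcomplex.topIso K).hom
    refine isContractibleSpace_of_homotopy this ⟨x, trivial⟩ ?_
    exact ((h x).precomp (Subcomplex.topIso K).hom).postcomp (Subcomplex.topIso K).inv
  · right
    exact fun n ↦ ⟨fun z ↦ hK ⟨K.map (SimplexCategory.const ⦋0⦌ n.unop 0).op z.1⟩⟩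

/-- The edge given by a homotopy of points. -/
noncomputable def edgeOfCylinder {K : SSet.{u}} (H : Δ[0] ⊗ Δ[1] ⟶ K) : K _⦋1⦌ :=
  yonedaEquiv (lift (toPoint _) (𝟙 _) ≫ H)

lemma edgeOfCylinder_app {K L : SSet.{u}} (H : Δ[0] ⊗ Δ[1] ⟶ K) (p : K ⟶ L) :
    p.app _ (edgeOfCylinder H) = edgeOfCylinder (H ≫ p) := rfl

lemma δ_one_edgeOfCylinder {K : SSet.{u}} (H : Δ[0] ⊗ Δ[1] ⟶ K) :
    K.δ 1 (edgeOfCylinder H) = yonedaEquiv (ι₀ ≫ H) := by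
  rw [edgeOfCylinder, ← stdSimplex.yonedaEquiv_δ_comp, ← Category.assoc]
  congr 2
  refine CartesianMonoidalCategory.hom_ext _ _ (by ext) ?_
  simp only [Category.assoc, lift_snd, Category.comp_id]
  exact stdSimplex.δ_one_eq_const

lemma δ_zero_edgeOfCylinder {K : SSet.{u}} (H : Δ[0] ⊗ Δ[1] ⟶ K) :
    K.δ 0 (edgeOfCylinder H) = yonedaEquiv (ι₁ ≫ H) := by
  rw [edgeOfCylinder, ← stdSimplex.yonedaEquiv_δ_comp, ← Category.assoc]
  congr 2
  refine CartesianMonoidalCategory.hom_ext _ _ (by ext) ?_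
  simp only [Category.assoc, lift_snd, Category.comp_id]
  exact stdSimplex.δ_zero_eq_const

lemma MapsHomotopic.pointsHomotopic {K : SSet.{u}} {a b : K _⦋0⦌}
    (h : MapsHomotopic (const a : Δ[0] ⟶ K) (const b)) : PointsHomotopic K a b := by
  obtain ⟨H, h₀, h₁⟩ := h.exists_cylinder
  exact ⟨edgeOfCylinder H, by rw [δ_one_edgeOfCylinder, h₀, yonedaEquiv_const],
    by rw [δ_zero_edgeOfCylinder, h₁, yonedaEquiv_const]⟩

/-- Any two vertices of a standard simplex are the ends of an edge, in one of the two directions. -/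
lemma exists_edge_stdSimplex (n : ℕ) (a b : Fin (n + 1)) :
    ∃ (γ : Δ[1] ⟶ (Δ[n] : SSet.{u})) (e e' : Fin 2),
      γ.app _ (stdSimplex.obj₀Equiv.symm e) = stdSimplex.obj₀Equiv.symm a ∧
        γ.app _ (stdSimplex.obj₀Equiv.symm e') = stdSimplex.obj₀Equiv.symm b := by
  have key (a b : Fin (n + 1)) (h : a ≤ b) (e : Fin 2) :
      (yonedaEquiv.symm (stdSimplex.edge.{u} n a b h)).app _ (stdSimplex.obj₀Equiv.symm e) =
        stdSimplex.obj₀Equiv.symm (![a, b] e) := by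
    apply stdSimplex.obj₀Equiv.injective
    rw [Equiv.apply_symm_apply]
    rfl
  obtain h | h := le_total a b
  · exact ⟨_, 0, 1, key a b h 0, key a b h 1⟩
  · exact ⟨_, 1, 0, key b a h 1, key b a h 0⟩

/-- A subspace of a Kan complex that is closed under paths is a Kan complex. -/
lemma kanComplex_subspaceOn (K : SSet.{u}) [KanComplex K] (P : Set (K _⦋0⦌))
    (hP : ∀ (γ : Δ[1] ⟶ K) (e e' : Fin 2), γ.app _ (stdSimplex.obj₀Equiv.symm e) ∈ P →
      γ.app _ (stdSimplex.obj₀Equiv.symm e') ∈ P) :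
    KanComplex (subspaceOn K P : SSet.{u}) := by
  refine kanComplex_of_exists_extension _ fun A B i hi f ↦ ?_
  simp only [J, MorphismProperty.iSup_iff] at hi
  obtain ⟨n, ⟨i⟩⟩ := hi
  -- The horn is filled in `K`. Its vertex `i` already lies in `P`, and every vertex of the simplex
  -- is joined to `i` by an edge, so the filler stays in the subspace.
  obtain ⟨g, hg⟩ := KanComplex.hornFilling (f ≫ Subcomplex.ι _)
  have hi : stdSimplex.obj₀Equiv.{u}.symm i ∈ Λ[n + 1, i].obj (op ⦋0⦌) := by
    obtain ⟨j, hj⟩ := exists_ne i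
    exact face_le_horn j i hj _
      ((stdSimplex.obj₀Equiv_symm_mem_face_iff _ _).2 (by simpa using hj.symm))
  have hgi : g.app _ (stdSimplex.obj₀Equiv.symm i) ∈ P := by
    have h₁ := congrArg (fun φ ↦ φ.app _ ⟨_, hi⟩) hg
    have h₂ := (f.app _ ⟨_, hi⟩).2 (𝟙 _)
    rw [op_id, K.map_id] at h₂
    exact (show _ = g.app _ _ from h₁) ▸ h₂
  refine ⟨Subcomplex.lift g ?_, by rw [← cancel_mono (Subcomplex.ι _), hg]; rfl⟩
  rintro m _ ⟨σ, rfl⟩ v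
  obtain ⟨p, hp⟩ := stdSimplex.obj₀Equiv.symm.surjective (Δ[n + 1].map v.op σ)
  obtain ⟨γ, e, e', h, h'⟩ := exists_edge_stdSimplex (n + 1) i p
  have := hP (γ ≫ g) e e'
  rw [NatTrans.comp_app, ConcreteCategory.comp_apply, ConcreteCategory.comp_apply, h, h', hp] at this
  rw [← NatTrans.naturality_apply g v.op σ]
  exact this hgi

end SSet

/-! ### Initial objects and the arrows out of them -/

namespace SimplicialSpace

open SSet CartesianMonoidalCategory Limits modelCategoryQuillen

variable {W : SimplicialSpace.{u}}

lemma fibreOverLevel_eq_constFibre {X Y : SimplicialSpace.{u}} (p : Y ⟶ X) (x : X.Ob) (n : ℕ) :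
    fibreOverLevel p x (op ⦋n⦌) = constFibre (p.app (op ⦋n⦌))
      ((X.map (SimplexCategory.const ⦋n⦌ ⦋0⦌ 0).op).app (op ⦋0⦌) x) := by
  ext l σ
  have : X.degenerate x (op ⦋n⦌) l = (SSet.const ((X.map (SimplexCategory.const ⦋n⦌ ⦋0⦌ 0).op).app
      (op ⦋0⦌) x) : Y _⦋n⦌ ⟶ X _⦋n⦌).app l σ :=
    NatTrans.naturality_apply (X.map (SimplexCategory.const ⦋n⦌ ⦋0⦌ 0).op) _ x
  change _ = _ ↔ _ = _
  rw [this]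

/-- The projection is a Kan fibration between Kan complexes in each level, so being an equivalence
there amounts to being a trivial fibration. -/
lemma isInitialOb_iff (hW : W.IsReedyFibrant) (x : W.Ob) :
    W.IsInitialOb x ↔ ∀ n : ℕ, I.rlp ((constFibre (W.expSrc.app (op ⦋n⦌))
      ((W.map (SimplexCategory.const ⦋n⦌ ⦋0⦌ 0).op).app (op ⦋0⦌) x)).ι ≫
        W.expTgt.app (op ⦋n⦌)) := by
  refine forall_congr' fun n ↦ ?_
  have := hW.fibration_expSrc_expTgt n
  have := hW.kanComplex_obj n
  change IsSpaceEquiv ((fibreOverLevel W.expSrc x (op ⦋n⦌)).ι ≫ W.expTgt.app (op ⦋n⦌)) ↔ _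
  rw [fibreOverLevel_eq_constFibre]
  have := fibration_constFibre (W.expSrc.app (op ⦋n⦌)) (W.expTgt.app (op ⦋n⦌))
    ((W.map (SimplexCategory.const ⦋n⦌ ⦋0⦌ 0).op).app (op ⦋0⦌) x)
  refine ⟨fun h ↦ ?_, isSpaceEquiv_of_rlp_boundary⟩
  have := isFibrant_of_fibration ((constFibre (W.expSrc.app (op ⦋n⦌))
      ((W.map (SimplexCategory.const ⦋n⦌ ⦋0⦌ 0).op).app (op ⦋0⦌) x)).ι ≫ W.expTgt.app (op ⦋n⦌))
  exact rlp_boundary_of_isSpaceEquiv _ h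

/-- The degeneracy W_0 ⟶ W_n turns `γ` into a path in W_n, along which the lifting property in level
`n` is transported. -/
lemma isInitialOb_of_path (hW : W.IsReedyFibrant) (γ : Δ[1] ⟶ W _⦋0⦌) (e e' : Fin 2)
    (h : W.IsInitialOb (γ.app _ (stdSimplex.obj₀Equiv.symm e))) :
    W.IsInitialOb (γ.app _ (stdSimplex.obj₀Equiv.symm e')) := by
  rw [isInitialOb_iff hW] at h ⊢
  intro n
  have := hW.fibration_expSrc_expTgt n
  exact rlp_boundary_constFibre_of_path (W.expSrc.app (op ⦋n⦌)) (W.expTgt.app (op ⦋n⦌))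
    (γ ≫ W.map (SimplexCategory.const ⦋n⦌ ⦋0⦌ 0).op) e e' (h n)

lemma IsInitialOb.rlp_boundary (hW : W.IsReedyFibrant) {x : W.Ob} (hx : W.IsInitialOb x) :
    I.rlp ((constFibre (W.expSrc.app (op ⦋0⦌)) x).ι ≫ W.expTgt.app (op ⦋0⦌)) := by
  have h := (isInitialOb_iff hW x).1 hx 0
  have e : (W.map (SimplexCategory.const ⦋0⦌ ⦋0⦌ 0).op).app (op ⦋0⦌) x = x := by
    have : (SimplexCategory.const ⦋0⦌ ⦋0⦌ 0) = 𝟙 _ :=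
      Subsingleton.elim _ _
    rw [this, op_id, W.map_id]
    rfl
  rwa [e] at h

/-- Families of morphisms out of an initial object exist. -/
lemma IsInitialOb.exists_family (hW : W.IsReedyFibrant) {x : W.Ob} (hx : W.IsInitialOb x)
    {B : SSet.{u}} (b : B ⟶ W _⦋0⦌) :
    ∃ u : B ⟶ W _⦋1⦌, u ≫ W.src = const x ∧ u ≫ W.tgt = b := by
  obtain ⟨l, -, hl⟩ := exists_lift_of_rlp_boundary (hx.rlp_boundary hW)
    (⊥ : B.Subcomplex).ι (Subcomplex.isInitialBot.to _) b (Subcomplex.isInitialBot.hom_ext _ _)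
  refine ⟨l ≫ Subcomplex.ι _ ≫ W.expToArrow, ?_, ?_⟩
  · rw [Category.assoc, Category.assoc, expToArrow_src, constFibre_ι_comp, comp_const]
  · rw [Category.assoc, Category.assoc, expToArrow_tgt, hl]

/-- Families of morphisms out of an initial object with the same targets are homotopic. -/
lemma IsInitialOb.exists_homotopy (hW : W.IsReedyFibrant) {x : W.Ob} (hx : W.IsInitialOb x)
    {B : SSet.{u}} (u v : B ⟶ W _⦋1⦌) (hu : u ≫ W.src = const x) (hv : v ≫ W.src = const x)
    (h : u ≫ W.tgt = v ≫ W.tgt) :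
    ∃ H : B ⊗ Δ[1] ⟶ W _⦋1⦌, ι₀ ≫ H = u ∧ ι₁ ≫ H = v ∧ H ≫ W.src = const x ∧
      H ≫ W.tgt = fst _ _ ≫ u ≫ W.tgt := by
  obtain ⟨u', hu'⟩ := exists_lift_constFibre (W.expSrc.app (op ⦋0⦌)) x (u ≫ W.arrowToExp)
    (by rw [Category.assoc, arrowToExp_expSrc, hu])
  obtain ⟨v', hv'⟩ := exists_lift_constFibre (W.expSrc.app (op ⦋0⦌)) x (v ≫ W.arrowToExp)
    (by rw [Category.assoc, arrowToExp_expSrc, hv])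
  -- The two families are the ends of a cylinder in the fibre over `x`, lifted over the constant
  -- homotopy of their common target.
  obtain ⟨l, hl₁, hl₂⟩ := exists_lift_of_rlp_boundary (hx.rlp_boundary hW)
    (double.desc (ι₀ (X := B)) ι₁) (double.desc u' v') (fst _ _ ≫ u ≫ W.tgt)
    (double.hom_ext
      (by rw [double.inl_desc_assoc, double.inl_desc_assoc, reassoc_of% hu', arrowToExp_expTgt,
            ι₀_fst_assoc])
      (by rw [double.inr_desc_assoc, double.inr_desc_assoc, reassoc_of% hv', arrowToExp_expTgt,
            ι₁_fst_assoc, h]))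
  have hl₀ := double.inl ≫= hl₁
  have hl₁ := double.inr ≫= hl₁
  simp only [double.inl_desc, double.inl_desc_assoc, double.inr_desc, double.inr_desc_assoc]
    at hl₀ hl₁
  refine ⟨l ≫ Subcomplex.ι _ ≫ W.expToArrow, ?_, ?_, ?_, ?_⟩
  · rw [reassoc_of% hl₀, reassoc_of% hu', arrowToExp_expToArrow, Category.comp_id]
  · rw [reassoc_of% hl₁, reassoc_of% hv', arrowToExp_expToArrow, Category.comp_id]
  · rw [Category.assoc, Category.assoc, expToArrow_src, constFibre_ι_comp, comp_const]
  · rw [Category.assoc, Category.assoc, expToArrow_tgt, hl₂]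

lemma mem_fibre_zero_iff {K L : SSet.{u}} (p : K ⟶ L) (y : L _⦋0⦌) (a : K _⦋0⦌) :
    a ∈ (fibre p y).obj (op ⦋0⦌) ↔ p.app _ a = y := by
  refine ⟨fun h ↦ ?_, fun h ↦ h ▸ mem_fibre_zero p a⟩
  obtain ⟨f, hf⟩ := (Subcomplex.mem_ofSimplex_obj_iff _ _).1 h
  refine hf.symm.trans ?_
  obtain rfl : f = 𝟙 _ := Subsingleton.elim _ _
  exact ConcreteCategory.congr_hom (L.map_id _) y

lemma Mor.src_eq {x y : W.Ob} (f : W.Mor x y) : W.src.app _ f.1 = x :=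
  (mem_fibre_zero_iff _ _ _).1 f.2.1

lemma Mor.tgt_eq {x y : W.Ob} (f : W.Mor x y) : W.tgt.app _ f.1 = y :=
  (mem_fibre_zero_iff _ _ _).1 f.2.2

/-- A morphism from its point. -/
def Mor.mk {x y : W.Ob} (f : (W _⦋1⦌) _⦋0⦌) (hx : W.src.app _ f = x) (hy : W.tgt.app _ f = y) :
    W.Mor x y :=
  ⟨f, (mem_fibre_zero_iff _ _ _).2 hx, (mem_fibre_zero_iff _ _ _).2 hy⟩

lemma mem_mapSpace_one {x y : W.Ob} (γ : (W _⦋1⦌) _⦋1⦌)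
    (hx : W.src.app _ γ = (const x : W _⦋1⦌ ⟶ W _⦋0⦌).app _ γ)
    (hy : W.tgt.app _ γ = (const y : W _⦋1⦌ ⟶ W _⦋0⦌).app _ γ) :
    γ ∈ (W.mapSpace x y).obj (op ⦋1⦌) :=
  ⟨(Subcomplex.mem_ofSimplex_obj_iff _ _).2 ⟨_, hx.symm⟩,
    (Subcomplex.mem_ofSimplex_obj_iff _ _).2 ⟨_, hy.symm⟩⟩

lemma IsInitialOb.nonempty_mor (hW : W.IsReedyFibrant) {x : W.Ob} (hx : W.IsInitialOb x)
    (y : W.Ob) : Nonempty (W.Mor x y) := by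
  obtain ⟨u, h₁, h₂⟩ := hx.exists_family hW (const y : Δ[0] ⟶ _)
  refine ⟨Mor.mk (yonedaEquiv u) ?_ ?_⟩
  · exact (yonedaEquiv_comp u W.src).symm.trans (by rw [h₁, yonedaEquiv_const])
  · exact (yonedaEquiv_comp u W.tgt).symm.trans (by rw [h₂, yonedaEquiv_const])

lemma IsInitialOb.morHomotopic (hW : W.IsReedyFibrant) {x y : W.Ob} (hx : W.IsInitialOb x)
    (f g : W.Mor x y) : W.MorHomotopic f g := by
  obtain ⟨H, h₀, h₁, hs, ht⟩ := hx.exists_homotopy hW (const f.1 : Δ[0] ⟶ _) (const g.1)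
    (by rw [const_comp, f.src_eq]) (by rw [const_comp, g.src_eq])
    (by rw [const_comp, const_comp, f.tgt_eq, g.tgt_eq])
  rw [const_comp, comp_const, f.tgt_eq] at ht
  refine ⟨⟨edgeOfCylinder H, mem_mapSpace_one _ ?_ ?_⟩, ?_, ?_⟩
  · rw [edgeOfCylinder_app, hs]; rfl
  · rw [edgeOfCylinder_app, ht]; rfl
  · refine Subtype.ext ((δ_one_edgeOfCylinder H).trans ?_)
    rw [h₀, yonedaEquiv_const]
  · refine Subtype.ext ((δ_zero_edgeOfCylinder H).trans ?_)
    rw [h₁, yonedaEquiv_const]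

end SimplicialSpace

lemma SSet.const_app_zero {X Y : SSet.{u}} (y : Y _⦋0⦌) (x : X _⦋0⦌) :
    (const y : X ⟶ Y).app _ x = y :=
  ConcreteCategory.congr_hom ((congrArg (fun f : ⦋0⦌ ⟶ ⦋0⦌ ↦ Y.map f.op)
    (Subsingleton.elim _ (𝟙 _))).trans (Y.map_id _)) y

/-! ### Composition, completeness and the contraction of W_init -/

namespace SimplicialSpace

open SSet CartesianMonoidalCategory Limits modelCategoryQuillen

variable {W : SimplicialSpace.{u}}

lemma spine_two_le_horn : spine.{u} 2 ≤ Λ[2, 1] := by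
  refine iSup_le fun i ↦ ?_
  rw [Subcomplex.ofSimplex_le_iff]
  fin_cases i
  · have : SimplexCategory.mkOfSucc (0 : Fin 2) = SimplexCategory.δ 2 := by decide
    simp only [Fin.zero_eta, this]
    exact (objEquiv_symm_δ_mem_horn_iff 2 1).2 (by decide)
  · have : SimplexCategory.mkOfSucc (1 : Fin 2) = SimplexCategory.δ 0 := by decide
    simp only [Fin.mk_one, this]
    exact (objEquiv_symm_δ_mem_horn_iff 0 1).2 (by decide)

lemma range_δ_le_spine (j : Fin 3) (hj : j ≠ 1) :
    Subcomplex.range (stdSimplex.δ j : Δ[1] ⟶ Δ[2]) ≤ spine.{u} 2 := by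
  have h (i : Fin 2) (h : SimplexCategory.mkOfSucc i = SimplexCategory.δ j) :
      Subcomplex.range (stdSimplex.δ j : Δ[1] ⟶ Δ[2]) ≤ spine.{u} 2 := by
    refine le_trans ?_ (le_iSup _ i)
    rw [h, Subcomplex.range_eq_ofSimplex]
    rfl
  obtain rfl | rfl : j = 0 ∨ j = 2 := by grind
  · exact h 1 (by decide)
  · exact h 0 (by decide)

/-- In a Segal space, composable morphisms are the short edges of a triangle. -/
lemma IsSegal.exists_triangle (hW : W.IsSegal) (f g : Δ[1] ⟶ homFrom Δ[0] W)
    (h : stdSimplex.δ 0 ≫ f = stdSimplex.δ 1 ≫ g) :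
    ∃ T : Δ[2] ⟶ homFrom Δ[0] W, stdSimplex.δ 2 ≫ T = f ∧ stdSimplex.δ 0 ≫ T = g := by
  let a : ∀ (j : Fin 3) (_ : j ≠ 1), Δ[1] ⟶ homFrom Δ[0] W := fun j _ ↦ if j = 0 then g else f
  have ha : horn.IsCompatible a := by
    rw [horn.isCompatible_iff]
    intro j k hj hk hjk
    obtain rfl : j = 0 := by grind
    obtain rfl : k = 2 := by grind
    exact h.symm
  -- The pair is first glued to a map on the horn `Λ[2, 1]`, where compatibility can be checked on
  -- faces, and then restricted to the spine.
  let φ : (spine.{u} 2 : SSet.{u}) ⟶ homFrom Δ[0] W :=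
    Subcomplex.homOfLE spine_two_le_horn ≫ ha.desc
  have := hW.reedyFibrant.fibration_precomp (spine.{u} 2).ι
  have := hW.reedyFibrant.kanComplex_map Δ[2]
  -- The Segal map is also a Kan fibration, hence a trivial one. Its strict surjectivity gives a
  -- triangle whose short edges equal `f` and `g`, not merely up to homotopy.
  have hr : I.rlp (Map.precomp (discreteEmb.map (spine.{u} 2).ι) W) :=
    rlp_boundary_of_isSpaceEquiv _ (hW.segal 2 le_rfl)
  obtain ⟨l, -, hl⟩ := exists_lift_of_rlp_boundary hr (⊥ : (Δ[0] : SSet.{u}).Subcomplex).ι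
    (Subcomplex.isInitialBot.to _) (toMap φ) (Subcomplex.isInitialBot.hom_ext _ _)
  have hl' : (spine.{u} 2).ι ≫ ofMap l = φ := by
    rw [← ofMap_naturality_left, hl, ofMap_toMap]
  have key (j : Fin 3) (hj : j ≠ 1) : stdSimplex.δ j ≫ ofMap l = a j hj := by
    have h₁ : stdSimplex.δ j = Subcomplex.lift (stdSimplex.δ j) (range_δ_le_spine j hj) ≫
      (spine.{u} 2).ι := rfl
    rw [h₁, Category.assoc, hl', ← ha.ι_desc j hj, ← Category.assoc]
    congr 1
  exact ⟨ofMap l, key 2 (by decide), key 0 (by decide)⟩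

lemma IsSegal.exists_isComposite (hW : W.IsSegal) {x y z : W.Ob} (f : W.Mor x y) (g : W.Mor y z) :
    ∃ k : W.Mor x z, W.IsComposite f g k := by
  obtain ⟨T, hf, hg⟩ := hW.exists_triangle (ofObj (n := 1) (const f.1)) (ofObj (const g.1)) (by
    apply yonedaEquiv.injective
    refine (yonedaEquiv_δ_comp 0 _).trans (Eq.trans ?_ (yonedaEquiv_δ_comp 1 _).symm)
    rw [yonedaEquiv_ofObj, yonedaEquiv_ofObj, const_comp, const_comp]
    exact congrArg const (f.tgt_eq.trans g.src_eq.symm))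
  let t : Δ[0] ⟶ W _⦋2⦌ := yonedaEquiv T
  have ht (i : Fin 3) : t ≫ W.δ i = yonedaEquiv (stdSimplex.δ i ≫ T) := (yonedaEquiv_δ_comp i T).symm
  have hf' : t ≫ W.δ 2 = const f.1 := by rw [ht, hf, yonedaEquiv_ofObj]
  have hg' : t ≫ W.δ 0 = const g.1 := by rw [ht, hg, yonedaEquiv_ofObj]
  have hf'' : (W.δ (2 : Fin 3)).app _ (yonedaEquiv t) = f.1 := by
    rw [← yonedaEquiv_comp, hf', yonedaEquiv_const]
  have hg'' : (W.δ (0 : Fin 3)).app _ (yonedaEquiv t) = g.1 := by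
    rw [← yonedaEquiv_comp, hg', yonedaEquiv_const]
  have hs : W.δ (1 : Fin 3) ≫ W.src = W.δ (2 : Fin 3) ≫ W.src :=
    (W.δ_comp_δ (i := (1 : Fin 2)) (j := 1) le_rfl).symm
  have ht : W.δ (1 : Fin 3) ≫ W.tgt = W.δ (0 : Fin 3) ≫ W.tgt :=
    W.δ_comp_δ (i := (0 : Fin 2)) (j := 0) le_rfl
  refine ⟨Mor.mk ((W.δ (1 : Fin 3)).app _ (yonedaEquiv t)) ?_ ?_, yonedaEquiv t, hf'', hg'', rfl⟩
  · refine (congrArg (fun φ ↦ φ.app _ (yonedaEquiv t)) hs).trans ?_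
    exact (congrArg (W.src.app _) hf'').trans f.src_eq
  · refine (congrArg (fun φ ↦ φ.app _ (yonedaEquiv t)) ht).trans ?_
    exact (congrArg (W.tgt.app _) hg'').trans g.tgt_eq

/-- A morphism between initial objects is a homotopy equivalence. -/
lemma IsSegal.isHoequiv_of_isInitialOb (hW : W.IsSegal) {x y : W.Ob} (hx : W.IsInitialOb x)
    (hy : W.IsInitialOb y) (f : W.Mor x y) : W.IsHoequiv f := by
  obtain ⟨g⟩ := hy.nonempty_mor hW.reedyFibrant x
  obtain ⟨k, hk⟩ := hW.exists_isComposite f g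
  obtain ⟨k', hk'⟩ := hW.exists_isComposite g f
  exact ⟨⟨g, k, hk, hx.morHomotopic hW.reedyFibrant _ _⟩,
    ⟨g, k', hk', hy.morHomotopic hW.reedyFibrant _ _⟩⟩

/-- In a complete Segal space, the source and target maps agree up to homotopy on the space of
homotopy equivalences. -/
lemma IsCompleteSegal.mapsHomotopic_src_tgt (hW : W.IsCompleteSegal) :
    MapsHomotopic (W.hoequiv.ι ≫ W.src) (W.hoequiv.ι ≫ W.tgt) := by
  have := hW.reedyFibrant.kanComplex_obj 0
  -- Only the right homotopy inverse `g` of s_0 is needed: s_0 is a section of both source and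
  -- target, so each of them is homotopic to `g`.
  obtain ⟨⟨g, hg⟩, -⟩ := hW.complete
  have hg : MapsHomotopic (g ≫ W.toHoequiv) (𝟙 _) := hg
  have hs : W.toHoequiv ≫ W.hoequiv.ι ≫ W.src = 𝟙 _ := W.δ_comp_σ_succ (i := (0 : Fin 1))
  have ht : W.toHoequiv ≫ W.hoequiv.ι ≫ W.tgt = 𝟙 _ := W.δ_comp_σ_self (i := (0 : Fin 1))
  have h₁ := hg.postcomp (W.hoequiv.ι ≫ W.src)
  have h₂ := hg.postcomp (W.hoequiv.ι ≫ W.tgt)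
  rw [Category.assoc, hs, Category.comp_id, Category.id_comp] at h₁
  rw [Category.assoc, ht, Category.comp_id, Category.id_comp] at h₂
  exact h₁.symm.trans h₂

lemma mem_init_zero_iff (x : W.Ob) : x ∈ W.init.obj (op ⦋0⦌) ↔ W.IsInitialOb x := by
  refine ⟨fun h ↦ ?_, fun h v ↦ ?_⟩
  · have := h (𝟙 _)
    rwa [op_id, (W _⦋0⦌).map_id] at this
  · obtain rfl : v = 𝟙 _ := Subsingleton.elim _ _
    rwa [op_id, (W _⦋0⦌).map_id]

/-- The space of initial objects contracts onto any initial object. -/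
lemma IsCompleteSegal.mapsHomotopic_init (hW : W.IsCompleteSegal)
    (x : (W.init : SSet.{u}) _⦋0⦌) : MapsHomotopic (const x) (𝟙 (W.init : SSet.{u})) := by
  have hx : W.IsInitialOb x.1 := (mem_init_zero_iff _).1 x.2
  obtain ⟨u, hs, ht⟩ := hx.exists_family hW.reedyFibrant W.init.ι
  -- Membership in W_hoequiv is tested on vertices, where `u` is an arrow from `x` to another
  -- initial object.
  have hu : Subcomplex.range u ≤ W.hoequiv := by
    rintro n _ ⟨σ, rfl⟩ v
    rw [← NatTrans.naturality_apply u v.op σ]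
    set τ := (W.init : SSet.{u}).map v.op σ
    have h₁ : W.src.app _ (u.app _ τ) = x.1 :=
      (congrArg (fun φ ↦ φ.app _ τ) hs).trans (const_app_zero _ _)
    have h₂ : W.tgt.app _ (u.app _ τ) = τ.1 := congrArg (fun φ ↦ φ.app _ τ) ht
    refine hW.isHoequiv_of_isInitialOb ?_ ?_ _
    · rwa [h₁]
    · rw [h₂]
      exact (mem_init_zero_iff _).1 τ.2
  have h := hW.mapsHomotopic_src_tgt.precomp (Subcomplex.lift u hu)
  rw [Subcomplex.lift_ι_assoc, Subcomplex.lift_ι_assoc, hs, ht] at h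
  obtain ⟨H, h₀, h₁⟩ := h.exists_cylinder
  -- Every vertex of the cylinder lies at one of its ends, where `H` takes the value `x` or is the
  -- inclusion of W_init.
  have hH : Subcomplex.range H ≤ W.init := by
    rintro n _ ⟨σ, rfl⟩ v
    rw [← NatTrans.naturality_apply H v.op σ]
    set τ := ((W.init : SSet.{u}) ⊗ Δ[1]).map v.op σ
    obtain ⟨y, z⟩ := τ
    obtain ⟨e, rfl⟩ := stdSimplex.obj₀Equiv.symm.surjective z
    have key : H.app _ (y, stdSimplex.obj₀Equiv.symm e) =
        (cylinderEnd (W.init : SSet.{u}) e ≫ H).app _ y :=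
      congrArg (fun z ↦ H.app _ (y, z)) (const_app_zero _ y).symm
    fin_cases e
    · refine Set.mem_of_eq_of_mem (key.trans (congrArg (fun φ ↦ φ.app _ y) h₀)) ?_
      exact Set.mem_of_eq_of_mem (const_app_zero _ _) hx
    · refine Set.mem_of_eq_of_mem (key.trans (congrArg (fun φ ↦ φ.app _ y) h₁)) ?_
      exact (mem_init_zero_iff _).1 y.2
  refine .mk (Subcomplex.lift H hH) ?_ ?_
  · rw [← cancel_mono (Subcomplex.ι _), Category.assoc, Subcomplex.lift_ι, h₀]
    rfl
  · rw [← cancel_mono (Subcomplex.ι _), Category.assoc, Subcomplex.lift_ι, h₁, Category.id_comp]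

end SimplicialSpace

theorem mainTheorem5 (W : SimplicialSpace.{u}) (hW : W.IsCompleteSegal) :
    SSet.IsNegOneTruncated (W.init : SSet.{u}) ∧
      (SSet.IsEmptySpace (W.init : SSet.{u}) ∨ SSet.IsContractibleSpace (W.init : SSet.{u})) ∧
      ∀ x y : W.Ob, W.IsInitialOb x → W.IsInitialOb y → SSet.PointsHomotopic (W _⦋0⦌) x y := by
  have := hW.reedyFibrant.kanComplex_obj 0
  have hK : SSet.KanComplex (W.init : SSet.{u}) := SSet.kanComplex_subspaceOn (W _⦋0⦌) _
    fun γ e e' ↦ SimplicialSpace.isInitialOb_of_path hW.reedyFibrant γ e e'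
  refine ⟨SSet.isNegOneTruncated_of_homotopy _ hW.mapsHomotopic_init, ?_, fun x y hx hy ↦ ?_⟩
  · by_cases h : Nonempty ((W.init : SSet.{u}) _⦋0⦌)
    · obtain ⟨x⟩ := h
      exact .inr (SSet.isContractibleSpace_of_homotopy hK x (hW.mapsHomotopic_init x))
    · exact .inl fun n ↦ ⟨fun z ↦ h ⟨(W.init : SSet.{u}).map (SimplexCategory.const ⦋0⦌ n.unop 0).op z⟩⟩
  · have h := hW.mapsHomotopic_init ⟨x, (SimplicialSpace.mem_init_zero_iff x).2 hx⟩
    -- Evaluating the contraction onto `x` at the point `y` gives the path.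
    have h' := (h.postcomp W.init.ι).precomp
      (SSet.const (X := Δ[0]) ⟨y, (SimplicialSpace.mem_init_zero_iff y).2 hy⟩)
    exact SSet.MapsHomotopic.pointsHomotopic h'
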